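/- Let $Q\subset\mathbb{R}^m$ be a lattice polytope, i.e. the convex hull of finitely many points of $\mathbb{Z}^m$, and let $\lambda$ be a linear form on $\mathbb{R}^m$ with $\lambda(\mathbb{Z}^m)\subset\mathbb{Z}$. For a bounded set $S\subset\mathbb{R}^m$ put \[W_\lambda(S,q)=\sum_{x\in\mathbb{Z}^m\cap S}q^{\lambda(x)}\in\mathbb{Q}(q).\] There exists $E_{\lambda,Q}(a,b,q)\in\mathbb{Q}(q)[a^{\pm1},b]$, Laurent polynomial in $a$ and polynomial in $b$, such that: a. for every integer $N\ge 0$, \[E_{\lambda,Q}(q^N,N,q)=W_\lambda(NQ,q);\] b. (Ehrhart reciprocity) for every integer $N\ge 1$, \[E_{\lambda,Q}(q^N,-N,q^{-1})=(-1)^{\dim Q}\,W_\lambda((NQ)^o,q),\] where $(NQ)^o$ is the relative interior of $NQ$ (its interior inside its affine hull), $\dim Q$ is the dimension of the affine hull of $Q$, and the left-hand side is obtained from $E_{\lambda,Q}(a,b,q)$ by applying $q\mapsto q^{-1}$ to the coefficients in $\mathbb{Q}(q)$ and substituting $a=q^N$, $b=-N$. -/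

import Mathlib

open scoped Pointwise LaurentPolynomial Polynomial

noncomputable section

namespace QEhrhart

/-- The standard embedding of the lattice `ℤ^m` into `ℝ^m`. -/
def latticePoint {m : ℕ} (x : Fin m → ℤ) : Fin m → ℝ := fun i => (x i : ℝ)

/-- A lattice polytope in `ℝ^m`: the convex hull of finitely many points of `ℤ^m`. -/
def IsLatticePolytope {m : ℕ} (Q : Set (Fin m → ℝ)) : Prop :=
  ∃ V : Finset (Fin m → ℤ), Q = convexHull ℝ (latticePoint '' (V : Set (Fin m → ℤ)))

/-- The dimension of a subset of `ℝ^m`: the dimension of its affine hull. -/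
def dim {m : ℕ} (Q : Set (Fin m → ℝ)) : ℕ := Module.finrank ℝ (vectorSpan ℝ Q)

/-- The variable `q`, as a unit of the field `ℚ(q)` of rational functions. -/
def q : (RatFunc ℚ)ˣ := Units.mk0 RatFunc.X RatFunc.X_ne_zero

/-- A bounded set contains only finitely many lattice points, so that the weighted sums
below are honest finite sums. -/
theorem finite_latticePoints {m : ℕ} {S : Set (Fin m → ℝ)} (hS : Bornology.IsBounded S) :
    {x : Fin m → ℤ | latticePoint x ∈ S}.Finite := by
  obtain ⟨R, hR⟩ := hS.exists_norm_le
  refine (Set.finite_Icc (fun _ : Fin m => -⌈R⌉) (fun _ => ⌈R⌉)).subset ?_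
  intro x hx
  have h : ∀ i, |(x i : ℝ)| ≤ (⌈R⌉ : ℝ) := fun i =>
    ((norm_le_pi_norm (latticePoint x) i).trans (hR _ hx)).trans (Int.le_ceil R)
  refine ⟨fun i => ?_, fun i => ?_⟩
  · have := (abs_le.mp (h i)).1
    show -⌈R⌉ ≤ x i
    exact_mod_cast this
  · have := (abs_le.mp (h i)).2
    show x i ≤ ⌈R⌉
    exact_mod_cast this

/-- The weighted lattice point sum `W_λ(S, q) = ∑_{x ∈ ℤ^m ∩ S} q^{λ(x)}` of a bounded set `S`,
an element of `ℚ(q)`. -/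
def weightedSum {m : ℕ} (lam : (Fin m → ℤ) →ₗ[ℤ] ℤ) (S : Set (Fin m → ℝ)) : RatFunc ℚ :=
  ∑ᶠ x ∈ {x : Fin m → ℤ | latticePoint x ∈ S}, ((q ^ lam x : (RatFunc ℚ)ˣ) : RatFunc ℚ)

theorem eval_X_inv_injective (K : Type) [Field K] :
    Function.Injective (Polynomial.eval₂RingHom (RatFunc.C (K := K)) (RatFunc.X : RatFunc K)⁻¹) := by
  have h : Transcendental K ((RatFunc.X : RatFunc K)⁻¹) := fun h => by
    have h2 := h.inv
    rw [inv_inv] at h2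
    exact RatFunc.transcendental_X h2
  exact transcendental_iff_injective.mp h

/-- The substitution `q ↦ q⁻¹` on `ℚ(q)`, as a ring homomorphism. -/
def invertQ : RatFunc ℚ →+* RatFunc ℚ :=
  RatFunc.liftRingHom (Polynomial.eval₂RingHom RatFunc.C (RatFunc.X : RatFunc ℚ)⁻¹)
    (nonZeroDivisors_le_comap_nonZeroDivisors_of_injective _ (eval_X_inv_injective ℚ))

/-- The ring `ℚ(q)[a^{±1}, b]`: polynomials in `b` whose coefficients are Laurent polynomials
in `a` over `ℚ(q)`. -/
abbrev TwoVarLaurent : Type := (RatFunc ℚ)[T;T⁻¹][X]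

/-- Evaluation of `E(a, b, q) ∈ ℚ(q)[a^{±1}, b]`: the ring homomorphism `σ` (the identity or
`q ↦ q⁻¹`) is applied to the coefficients in `ℚ(q)`, the variable `a` is replaced by
the unit `α` and `b` by `β`. -/
def evalAt (σ : RatFunc ℚ →+* RatFunc ℚ) (α : (RatFunc ℚ)ˣ) (β : RatFunc ℚ)
    (E : TwoVarLaurent) : RatFunc ℚ :=
  Polynomial.eval₂ (LaurentPolynomial.eval₂ σ α) β E

end QEhrhart

end

noncomputable section

namespace QEhrhart

/-! Put `Q` at height 1 and take the cone over it inside its linear span; the lattice points of `NQ`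
become those of the cone at height `N`. A linear program with generic costs yields a regular
triangulation into simplicial cones, and a generic interior vector `Y` decides which facets each
piece keeps. The cone is then the disjoint union of the pieces half-open along `Y`, and its relative
interior the disjoint union of the same pieces half-open along `-Y`
(`exists_halfOpen_triangulation`), so no inclusion-exclusion is needed.

In a half-open simplicial cone with generators `e i`, every lattice point is uniquely a point `p` of
the half-open fundamental box plus a combination of the generators with natural coefficients. The
sum at height `N` is therefore the sum over `p` of `q ^ lam p` times the complete homogeneous
polynomial of degree `N - ht p` in the `q ^ lam (e i)` (`finsum_halfOpen_eq`).

As a function of the degree, this polynomial is built by first-order recurrences, hence is an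
exponential polynomial; running the recurrences backwards gives its reciprocity law
(`exists_isExpPoly_completeHomogeneous`). The reflection `p ↦ ∑ e i - p` exchanges the boxes for `Y`
and `-Y`, which gives reciprocity for each piece (`exists_isExpPoly_halfOpen`). Every piece has `dim
Q + 1` generators, so the signs agree and the pieces add up. -/

/-- Exponential polynomials: sequences `n ↦ E(q^n, n, q)` with `E ∈ ℚ(q)[a^{±1}, b]`. -/
def IsExpPoly (f : ℤ → RatFunc ℚ) : Prop :=
  ∃ E : TwoVarLaurent, ∀ n : ℤ, f n = evalAt (RingHom.id _) (q ^ n) (n : RatFunc ℚ) E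

theorem q_val : (q : RatFunc ℚ) = RatFunc.X := rfl

/-! ### Closure properties of exponential polynomials -/

namespace IsExpPoly

variable {f g : ℤ → RatFunc ℚ}

theorem add (hf : IsExpPoly f) (hg : IsExpPoly g) : IsExpPoly fun n => f n + g n := by
  obtain ⟨E, hE⟩ := hf
  obtain ⟨F, hF⟩ := hg
  exact ⟨E + F, fun n => by simp only [hE, hF, evalAt, Polynomial.eval₂_add]⟩

theorem mul (hf : IsExpPoly f) (hg : IsExpPoly g) : IsExpPoly fun n => f n * g n := by
  obtain ⟨E, hE⟩ := hf
  obtain ⟨F, hF⟩ := hg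
  exact ⟨E * F, fun n => by simp only [hE, hF, evalAt, Polynomial.eval₂_mul]⟩

theorem const (c : RatFunc ℚ) : IsExpPoly fun _ => c :=
  ⟨Polynomial.C (LaurentPolynomial.C c), fun n => by simp [evalAt]⟩

theorem id : IsExpPoly fun n => (n : RatFunc ℚ) :=
  ⟨Polynomial.X, fun n => by simp [evalAt]⟩

theorem zpow (j : ℤ) : IsExpPoly fun n => (q : RatFunc ℚ) ^ (j * n) :=
  ⟨Polynomial.C (LaurentPolynomial.T j), fun n => by
    simp only [evalAt, Polynomial.eval₂_C, LaurentPolynomial.eval₂_T]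
    rw [← zpow_mul, mul_comm n j, Units.val_zpow_eq_zpow_val]⟩

theorem pow (hf : IsExpPoly f) (k : ℕ) : IsExpPoly fun n => f n ^ k := by
  induction k with
  | zero => simpa using const 1
  | succ k ih => simpa only [pow_succ] using ih.mul hf

theorem sum {α : Type*} (s : Finset α) {F : α → ℤ → RatFunc ℚ}
    (h : ∀ a ∈ s, IsExpPoly (F a)) : IsExpPoly fun n => ∑ a ∈ s, F a n := by
  classical
  induction s using Finset.induction_on with
  | empty => simpa using const 0
  | insert a s ha ih =>
    simp only [Finset.sum_insert ha]
    exact (h a (by simp)).add (ih fun b hb => h b (by simp [hb]))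

/-- On a monomial, `q ^ (j * (n - k))` is a constant times `q ^ (j * n)`, and `(n - k) ^ i` is a
polynomial in `n`. -/
theorem shift (hf : IsExpPoly f) (k : ℤ) : IsExpPoly fun n => f (n - k) := by
  obtain ⟨E, hE⟩ := hf
  have : f = fun n : ℤ => evalAt (RingHom.id _) (q ^ n) (n : RatFunc ℚ) E := funext hE
  clear hE
  subst this
  induction E using Polynomial.induction_on' with
  | add E F hE hF => simpa only [evalAt, Polynomial.eval₂_add] using hE.add hF
  | monomial i a =>
    induction a using LaurentPolynomial.induction_on' with
    | add a b ha hb =>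
      simp only [map_add, evalAt, Polynomial.eval₂_add] at *
      exact ha.add hb
    | C_mul_T j c =>
      simp only [evalAt, Polynomial.eval₂_monomial, LaurentPolynomial.eval₂_C_mul_T,
        ← zpow_mul, RingHom.id_apply, Units.val_zpow_eq_zpow_val]
      have h := (((const c).mul (const ((q : RatFunc ℚ) ^ (-(k * j))))).mul (zpow j)).mul
        ((id.add (const (-(k : RatFunc ℚ)))).pow i)
      convert h using 2 with n
      push_cast
      rw [show (n - k) * j = -(k * j) + j * n by ring, zpow_add₀ (Units.ne_zero q)]
      ring

end IsExpPoly

/-! ### Summation of exponential polynomials and first-order recurrences -/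

/-- `g` is the difference sequence of an exponential polynomial. -/
def IsExpPolyDiff (g : ℤ → RatFunc ℚ) : Prop :=
  ∃ F, IsExpPoly F ∧ ∀ n, F n - F (n - 1) = g n

namespace IsExpPolyDiff

variable {f g : ℤ → RatFunc ℚ}

theorem add (hf : IsExpPolyDiff f) (hg : IsExpPolyDiff g) : IsExpPolyDiff fun n => f n + g n := by
  obtain ⟨F, hF, h⟩ := hf
  obtain ⟨G, hG, h'⟩ := hg
  exact ⟨_, hF.add hG, fun n => by simp only [← h, ← h']; ring⟩

theorem const_mul (c : RatFunc ℚ) (hf : IsExpPolyDiff f) : IsExpPolyDiff fun n => c * f n := by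
  obtain ⟨F, hF, h⟩ := hf
  exact ⟨_, (IsExpPoly.const c).mul hF, fun n => by simp only [← h]; ring⟩

theorem sum {α : Type*} (s : Finset α) {F : α → ℤ → RatFunc ℚ}
    (h : ∀ a ∈ s, IsExpPolyDiff (F a)) : IsExpPolyDiff fun n => ∑ a ∈ s, F a n := by
  classical
  induction s using Finset.induction_on with
  | empty => exact ⟨_, IsExpPoly.const 0, by simp⟩
  | insert a s ha ih =>
    simp only [Finset.sum_insert ha]
    exact (h a (by simp)).add (ih fun b hb => h b (by simp [hb]))

theorem of_isExpPoly_sub (hf : IsExpPoly f) : IsExpPolyDiff fun n => f n - f (n - 1) :=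
  ⟨f, hf, fun _ => rfl⟩

theorem q_zpow_ne_one {j : ℤ} (hj : j ≠ 0) : (q : RatFunc ℚ) ^ j ≠ 1 := by
  have key : ∀ k : ℕ, k ≠ 0 → (q : RatFunc ℚ) ^ k ≠ 1 := by
    intro k hk h
    rw [q_val, ← RatFunc.algebraMap_X, ← map_pow, ← map_one (algebraMap ℚ[X] (RatFunc ℚ))] at h
    have h2 := congrArg Polynomial.natDegree (RatFunc.algebraMap_injective ℚ h)
    simp at h2
    exact hk h2
  obtain ⟨k, rfl | rfl⟩ := j.eq_nat_or_neg
  · rw [zpow_natCast]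
    exact key k (by simpa using hj)
  · rw [zpow_neg, zpow_natCast, Ne, inv_eq_one]
    exact key k (by simpa using hj)

/-- The difference of `q ^ (j * n) * n ^ i` has leading coefficient `1 - q ^ (-j)`, nonzero for `j ≠
0` because `q` is not a root of unity. For `j = 0` one takes `n ^ (i + 1)` instead, with leading
coefficient `i + 1`; this resonance is what creates powers of `b`. -/
theorem monomial (j : ℤ) (i : ℕ) :
    IsExpPolyDiff fun n => (q : RatFunc ℚ) ^ (j * n) * (n : RatFunc ℚ) ^ i := by
  induction i using Nat.strong_induction_on with
  | _ i ih =>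
  have expand : ∀ (k : ℕ) (n : ℤ), ((n - 1 : ℤ) : RatFunc ℚ) ^ k =
      (n : RatFunc ℚ) ^ k + ∑ l ∈ Finset.range k,
        ((-1) ^ (k - l) * (k.choose l : RatFunc ℚ)) * (n : RatFunc ℚ) ^ l := by
    intro k n
    push_cast
    rw [sub_eq_add_neg, add_pow, Finset.sum_range_succ, add_comm]
    simp only [Nat.sub_self, pow_zero, mul_one, Nat.choose_self, Nat.cast_one]
    congr 1
    exact Finset.sum_congr rfl fun l _ => by ring
  have qs : ∀ n : ℤ, (q : RatFunc ℚ) ^ (j * (n - 1)) = (q : RatFunc ℚ) ^ (-j) * q ^ (j * n) :=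
    fun n => by rw [← zpow_add₀ (Units.ne_zero q)]; congr 1; ring
  -- The terms of lower degree in `n` are removed by the induction hypothesis.
  have solve : ∀ (c : RatFunc ℚ) (d : ℕ → RatFunc ℚ), c ≠ 0 →
      IsExpPolyDiff (fun n => c * ((q : RatFunc ℚ) ^ (j * n) * (n : RatFunc ℚ) ^ i) +
        ∑ l ∈ Finset.range i, d l * ((q : RatFunc ℚ) ^ (j * n) * (n : RatFunc ℚ) ^ l)) →
      IsExpPolyDiff fun n => (q : RatFunc ℚ) ^ (j * n) * (n : RatFunc ℚ) ^ i := by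
    intro c d hc h
    have h2 := (h.add ((sum (Finset.range i) fun l hl =>
      (ih l (Finset.mem_range.1 hl)).const_mul (d l)).const_mul (-1))).const_mul c⁻¹
    convert h2 using 2 with n
    field_simp
    ring
  by_cases hj : j = 0
  · subst hj
    refine solve ((i : RatFunc ℚ) + 1)
      (fun l => -((-1) ^ (i + 1 - l) * ((i + 1).choose l : RatFunc ℚ))) (by exact_mod_cast i.succ_ne_zero) ?_
    convert of_isExpPoly_sub (IsExpPoly.id.pow (i + 1)) using 2 with n
    rw [expand, Finset.sum_range_succ]
    simp only [neg_mul, Finset.sum_neg_distrib, zero_mul, zpow_zero, one_mul]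
    simp
    ring
  · refine solve (1 - (q : RatFunc ℚ) ^ (-j))
      (fun l => -((q : RatFunc ℚ) ^ (-j) * ((-1) ^ (i - l) * (i.choose l : RatFunc ℚ))))
      (sub_ne_zero.2 (q_zpow_ne_one (neg_ne_zero.2 hj)).symm) ?_
    convert of_isExpPoly_sub ((IsExpPoly.zpow j).mul (IsExpPoly.id.pow i)) using 2 with n
    rw [expand, qs, mul_add, Finset.mul_sum, sub_add_eq_sub_sub,
      sub_eq_add_neg _ (Finset.sum _ _), ← Finset.sum_neg_distrib]
    congr 1
    · ring
    · exact Finset.sum_congr rfl fun l _ => by ring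

theorem of_isExpPoly (hf : IsExpPoly f) : IsExpPolyDiff f := by
  obtain ⟨E, hE⟩ := hf
  have : f = fun n : ℤ => evalAt (RingHom.id _) (q ^ n) (n : RatFunc ℚ) E := funext hE
  clear hE
  subst this
  induction E using Polynomial.induction_on' with
  | add E F hE hF => simpa only [evalAt, Polynomial.eval₂_add] using hE.add hF
  | monomial i a =>
    induction a using LaurentPolynomial.induction_on' with
    | add a b ha hb =>
      simp only [map_add, evalAt, Polynomial.eval₂_add] at *
      exact ha.add hb
    | C_mul_T j c =>
      simp only [evalAt, Polynomial.eval₂_monomial, LaurentPolynomial.eval₂_C_mul_T,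
        ← zpow_mul, RingHom.id_apply, Units.val_zpow_eq_zpow_val]
      convert (monomial j i).const_mul c using 2 with n
      rw [mul_assoc, mul_comm n j]

end IsExpPolyDiff

/-- Variation of constants: with `F n = q ^ (l * n) * U n` the equation becomes `U n - U (n - 1) = q
^ (-l * n) * g n`, and `U` is normalised by subtracting `U (-1)`. -/
theorem IsExpPoly.exists_recurrence {g : ℤ → RatFunc ℚ} (hg : IsExpPoly g) (l : ℤ) :
    ∃ F, IsExpPoly F ∧ F (-1) = 0 ∧ ∀ n, F n = (q : RatFunc ℚ) ^ l * F (n - 1) + g n := by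
  obtain ⟨U, hU, h⟩ := IsExpPolyDiff.of_isExpPoly ((IsExpPoly.zpow (-l)).mul hg)
  refine ⟨_, (IsExpPoly.zpow l).mul (hU.add (IsExpPoly.const (-U (-1)))), by simp, fun n => ?_⟩
  have h2 : U n = U (n - 1) + (q : RatFunc ℚ) ^ (-l * n) * g n := by linear_combination h n
  have h3 : (q : RatFunc ℚ) ^ (l * n) = q ^ l * q ^ (l * (n - 1)) := by
    rw [← zpow_add₀ (Units.ne_zero q)]; congr 1; ring
  have h4 : (q : RatFunc ℚ) ^ (l * n) * q ^ (-l * n) = 1 := by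
    rw [← zpow_add₀ (Units.ne_zero q)]; simp
  rw [h2, h3]
  rw [h3] at h4
  linear_combination g n * h4

/-! ### The substitution inverting `q` -/

theorem invertQ_q_zpow (n : ℤ) : invertQ ((q : RatFunc ℚ) ^ n) = (q : RatFunc ℚ) ^ (-n) := by
  have : invertQ (q : RatFunc ℚ) = (q : RatFunc ℚ)⁻¹ := by
    have h := RatFunc.liftRingHom_apply_div (K := ℚ)
      (Polynomial.eval₂RingHom RatFunc.C (RatFunc.X : RatFunc ℚ)⁻¹)
      (nonZeroDivisors_le_comap_nonZeroDivisors_of_injective _ (eval_X_inv_injective ℚ))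
      Polynomial.X 1
    simp only [Polynomial.coe_eval₂RingHom, Polynomial.eval₂_X, map_one, div_one,
      RatFunc.algebraMap_X] at h
    exact h
  rw [map_zpow₀, this, inv_zpow, zpow_neg]

/-- This turns the left side of reciprocity into the value of the sequence at the negative index
`-n`, followed by `invertQ`. -/
theorem evalAt_invertQ (E : TwoVarLaurent) (n : ℤ) :
    evalAt invertQ (q ^ n) (-(n : RatFunc ℚ)) E =
      invertQ (evalAt (RingHom.id _) (q ^ (-n)) ((-n : ℤ) : RatFunc ℚ) E) := by
  induction E using Polynomial.induction_on' with
  | add E F hE hF => simp only [evalAt, Polynomial.eval₂_add, map_add] at *; rw [hE, hF]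
  | monomial i a =>
    induction a using LaurentPolynomial.induction_on' with
    | add a b ha hb =>
      simp only [map_add, evalAt, Polynomial.eval₂_add] at *
      rw [ha, hb]
    | C_mul_T j c =>
      simp only [evalAt, Polynomial.eval₂_monomial, LaurentPolynomial.eval₂_C_mul_T,
        ← zpow_mul, RingHom.id_apply, Units.val_zpow_eq_zpow_val]
      simp only [map_mul, invertQ_q_zpow, map_pow, map_intCast]
      simp

/-! ### Complete homogeneous polynomials and their reciprocity -/

/-- The complete homogeneous symmetric polynomial of degree `M` in the `x i`, `i ∈ s`;
it is `0` for `M < 0`. -/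
def completeHomogeneous {ι : Type*} (s : Finset ι) (x : ι → RatFunc ℚ) (M : ℤ) : RatFunc ℚ :=
  if 0 ≤ M then PowerSeries.coeff M.toNat (∏ i ∈ s, PowerSeries.mk fun n => x i ^ n) else 0

section completeHomogeneous

variable {ι : Type*}

theorem completeHomogeneous_of_neg (s : Finset ι) (x : ι → RatFunc ℚ) {M : ℤ} (hM : M < 0) :
    completeHomogeneous s x M = 0 := if_neg (not_le.2 hM)

theorem completeHomogeneous_natCast [DecidableEq ι] (s : Finset ι) (x : ι → RatFunc ℚ) (M : ℕ) :
    completeHomogeneous s x M =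
      ∑ l ∈ Finset.finsuppAntidiag s M, ∏ i ∈ s, x i ^ l i := by
  simp [completeHomogeneous, PowerSeries.coeff_prod]

/-- The geometric series `G` in the variable `x a` satisfies `G = x a * X * G + 1`; multiply by the
other factors and compare coefficients. -/
theorem completeHomogeneous_cons {a : ι} {s : Finset ι} (ha : a ∉ s) (x : ι → RatFunc ℚ) (M : ℤ) :
    completeHomogeneous (s.cons a ha) x M =
      x a * completeHomogeneous (s.cons a ha) x (M - 1) + completeHomogeneous s x M := by
  rcases lt_or_ge M 0 with hM | hM
  · simp [completeHomogeneous_of_neg _ _ hM, completeHomogeneous_of_neg _ _ (show M - 1 < 0 by lia)]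
  lift M to ℕ using hM
  have h : (PowerSeries.mk fun n => x a ^ n) =
      PowerSeries.C (x a) * (PowerSeries.X * PowerSeries.mk fun n => x a ^ n) + 1 := by
    ext n
    cases n with
    | zero => simp
    | succ n => simp [PowerSeries.coeff_succ_X_mul, PowerSeries.coeff_one, pow_succ']
  set P := ∏ i ∈ s, PowerSeries.mk fun n => x i ^ n with hP
  have h2 : (PowerSeries.mk fun n => x a ^ n) * P =
      PowerSeries.C (x a) * (PowerSeries.X * ((PowerSeries.mk fun n => x a ^ n) * P)) + P := by
    conv_lhs => rw [h]
    ring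
  simp only [completeHomogeneous, Finset.prod_cons, ← hP]
  cases M with
  | zero =>
    simp
  | succ M =>
    have h3 := congrArg (PowerSeries.coeff (M + 1)) h2
    rw [map_add, PowerSeries.coeff_C_mul, PowerSeries.coeff_succ_X_mul] at h3
    rw [if_pos (by positivity), if_pos (by push_cast; lia), if_pos (by positivity)]
    simpa using h3

theorem completeHomogeneous_singleton (a : ι) (x : ι → RatFunc ℚ) (M : ℕ) :
    completeHomogeneous {a} x M = x a ^ M := by
  simp [completeHomogeneous]

/-- The complete homogeneous symmetric polynomials in powers of `q` extend to an exponential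
polynomial, which satisfies a reciprocity law. -/
theorem exists_isExpPoly_completeHomogeneous {s : Finset ι} (hs : s.Nonempty) (l : ι → ℤ) :
    ∃ H, IsExpPoly H ∧
      (∀ n : ℤ, -(s.card : ℤ) < n →
        H n = completeHomogeneous s (fun i => (q : RatFunc ℚ) ^ l i) n) ∧
      ∀ n : ℤ, n < 0 → H n = (-1) ^ (s.card - 1) * (q : RatFunc ℚ) ^ (-∑ i ∈ s, l i) *
        completeHomogeneous s (fun i => (q : RatFunc ℚ) ^ (-l i)) (-n - s.card) := by
  have q0 : (q : RatFunc ℚ) ≠ 0 := Units.ne_zero q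
  induction hs using Finset.Nonempty.cons_induction with
  | singleton a =>
    refine ⟨_, IsExpPoly.zpow (l a), fun n hn => ?_, fun n hn => ?_⟩
    · simp only [Finset.card_singleton, Nat.cast_one] at hn
      lift n to ℕ using by lia
      rw [completeHomogeneous_singleton, ← zpow_natCast, ← zpow_mul]
    · obtain ⟨k, hk⟩ : ∃ k : ℕ, -n - 1 = k := ⟨(-n - 1).toNat, by lia⟩
      simp only [Finset.card_singleton, Nat.cast_one, hk, completeHomogeneous_singleton]
      rw [← zpow_natCast (_ ^ _) k, ← zpow_mul, ← hk]
      simp only [Nat.sub_self, pow_zero, one_mul, Finset.sum_singleton]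
      rw [← zpow_add₀ q0]
      congr 1
      ring
  | cons a s ha hs ih =>
    obtain ⟨H, hH, h1, h2⟩ := ih
    obtain ⟨F, hF, hF1, hrec⟩ := hH.exists_recurrence (l a)
    have hcard : 1 ≤ s.card := hs.card_pos
    have hneg : ∀ n : ℤ, n < 0 → F n =
        (-1) ^ ((s.cons a ha).card - 1) * (q : RatFunc ℚ) ^ (-∑ i ∈ s.cons a ha, l i) *
        completeHomogeneous (s.cons a ha) (fun i => (q : RatFunc ℚ) ^ (-l i))
          (-n - (s.cons a ha).card) := by
      -- Solving the recurrence for the earlier value, backwards from `F (-1) = 0`, gives up to sign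
      -- and a power of `q` the recurrence `completeHomogeneous_cons` in the inverse variables.
      have aux : ∀ k : ℕ, F (-1 - k) =
        (-1) ^ s.card * (q : RatFunc ℚ) ^ (-∑ i ∈ s.cons a ha, l i) *
        completeHomogeneous (s.cons a ha) (fun i => (q : RatFunc ℚ) ^ (-l i)) (k - s.card) := by
        intro k
        induction k with
        | zero =>
          rw [completeHomogeneous_of_neg _ _ (by push_cast; lia)]
          simpa using hF1
        | succ k ihk =>
          have e := hrec (-1 - k)
          rw [ihk, h2 _ (by lia), show -(-1 - (k : ℤ)) - s.card = (k + 1 : ℕ) - s.card by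
            push_cast; ring, show (-1 - (k : ℤ)) - 1 = -1 - (k + 1 : ℕ) by push_cast; ring] at e
          rw [completeHomogeneous_cons ha]
          rw [show ((k + 1 : ℕ) : ℤ) - s.card - 1 = k - s.card by push_cast; ring]
          obtain ⟨c, hc⟩ : ∃ c, s.card = c + 1 := ⟨s.card - 1, by lia⟩
          rw [hc] at e ⊢
          simp only [Nat.add_sub_cancel, Finset.sum_cons, neg_add] at e ⊢
          have e2 : (q : RatFunc ℚ) ^ (l a) * q ^ (-l a) = 1 := by
            rw [← zpow_add₀ q0]; simp
          rw [zpow_add₀ q0] at e ⊢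
          generalize completeHomogeneous (s.cons a ha) (fun i => (q : RatFunc ℚ) ^ (-l i))
            ((k : ℤ) - (c + 1 : ℕ)) = u at *
          generalize completeHomogeneous s (fun i => (q : RatFunc ℚ) ^ (-l i))
            (((k + 1 : ℕ) : ℤ) - (c + 1 : ℕ)) = v at *
          generalize F (-1 - (k + 1 : ℕ)) = w at *
          generalize (q : RatFunc ℚ) ^ (-∑ i ∈ s, l i) = t at *
          generalize (q : RatFunc ℚ) ^ (-l a) = y at *
          generalize (q : RatFunc ℚ) ^ (l a) = x at *
          rw [pow_succ] at e ⊢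
          linear_combination (-y) * e - w * e2
      intro n hn
      obtain ⟨k, hk⟩ : ∃ k : ℕ, n = -1 - k := ⟨(-1 - n).toNat, by lia⟩
      subst hk
      rw [aux]
      simp only [Finset.card_cons, Nat.add_sub_cancel]
      congr 2
      push_cast
      ring
    refine ⟨F, hF, fun n hn => ?_, hneg⟩
    rw [Finset.card_cons] at hn
    push_cast at hn
    -- In the window between `-card` and `0` both sides vanish. This extra range is needed later,
    -- where `N - ht p` may be negative.
    rcases lt_or_ge n 0 with h | h
    · rw [hneg n h, completeHomogeneous_of_neg _ _ h, completeHomogeneous_of_neg, mul_zero]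
      rw [Finset.card_cons]
      push_cast
      lia
    · lift n to ℕ using h
      induction n with
      | zero =>
        rw [completeHomogeneous_cons ha, ← h1 _ (by simpa using hs.card_pos), hrec,
          completeHomogeneous_of_neg _ _ (by simp)]
        simp [hF1]
      | succ n ihn =>
        rw [completeHomogeneous_cons ha, ← h1 _ (by lia), hrec,
          show ((n + 1 : ℕ) : ℤ) - 1 = n by simp, ihn (by lia)]

theorem map_completeHomogeneous (φ : RatFunc ℚ →+* RatFunc ℚ) (s : Finset ι)
    (x : ι → RatFunc ℚ) (M : ℤ) :
    φ (completeHomogeneous s x M) = completeHomogeneous s (fun i => φ (x i)) M := by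
  classical
  rcases lt_or_ge M 0 with hM | hM
  · simp [completeHomogeneous_of_neg _ _ hM]
  · lift M to ℕ using hM
    simp [completeHomogeneous_natCast]

end completeHomogeneous

/-! ### Half-open simplicial cones -/

/-- `c` belongs to the half-open orthant determined by the generic vector `y`: the points
`c + ε • y` lie in the open orthant for all small `ε > 0`. -/
def HalfOpen {ι : Type*} (c y : ι → ℝ) : Prop :=
  ∀ i, 0 < c i ∨ (c i = 0 ∧ 0 < y i)

/-- The remainder `c - n` lies in `[0, 1)` when `y > 0`, so `n` is the floor; it lies in `(0, 1]`
when `y < 0`, so `n` is the ceiling minus one. -/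
theorem exists_halfOpen_decomposition {c y : ℝ} (hy : y ≠ 0) (hc : 0 < c ∨ (c = 0 ∧ 0 < y)) :
    ∃ n : ℕ, (0 < c - n ∨ (c - n = 0 ∧ 0 < y)) ∧
      (0 < 1 - (c - n) ∨ (1 - (c - n) = 0 ∧ 0 < -y)) := by
  have hc0 : 0 ≤ c := by rcases hc with h | h <;> linarith
  rcases hy.lt_or_gt with h | h
  · have hc1 : 0 < c := by rcases hc with h | h <;> linarith
    have h1 : 0 < ⌈c⌉₊ := Nat.ceil_pos.2 hc1
    have h2 := Nat.ceil_lt_add_one hc0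
    have h3 := Nat.le_ceil c
    refine ⟨⌈c⌉₊ - 1, ?_⟩
    rw [Nat.cast_sub h1, Nat.cast_one]
    refine ⟨Or.inl (by linarith), ?_⟩
    rcases h3.lt_or_eq with h4 | h4
    · exact Or.inl (by linarith)
    · exact Or.inr ⟨by linarith, by linarith⟩
  · have h2 := Nat.floor_le hc0
    have h3 := Nat.lt_floor_add_one c
    refine ⟨⌊c⌋₊, ?_, Or.inl (by linarith)⟩
    rcases h2.lt_or_eq with h4 | h4
    · exact Or.inl (by linarith)
    · exact Or.inr ⟨by linarith, h⟩

theorem prod_zpow_eq_zpow_sum {α G : Type*} [CommGroupWithZero G] {x : G} (hx : x ≠ 0)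
    (s : Finset α) (k : α → ℤ) : ∏ a ∈ s, x ^ k a = x ^ ∑ a ∈ s, k a := by
  classical
  induction s using Finset.induction_on with
  | empty => simp
  | insert a s ha ih => rw [Finset.prod_insert ha, Finset.sum_insert ha, zpow_add₀ hx, ih]

section SimplicialCone

variable {ι M : Type*} [AddCommGroup M] (κ : M →+ (ι → ℝ)) (e : ι → M)
  (ht lam : M →+ ℤ) (y : ι → ℝ)

/-- The lattice points of the half-open fundamental parallelepiped. -/
def halfOpenBox : Set M := {p | HalfOpen (κ p) y ∧ HalfOpen (1 - κ p) (-y)}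

variable {κ e ht lam y}

theorem halfOpenBox_bounds {p : M} (hp : p ∈ halfOpenBox κ y) (i : ι) :
    (0 ≤ κ p i ∧ κ p i ≤ 1) ∧ (0 < y i → κ p i < 1) ∧ (y i < 0 → 0 < κ p i) := by
  have h1 := hp.1 i
  have h2 := hp.2 i
  simp only [Pi.sub_apply, Pi.one_apply, Pi.neg_apply] at h2
  refine ⟨⟨?_, ?_⟩, fun h => ?_, fun h => ?_⟩
  · rcases h1 with h | h <;> linarith
  · rcases h2 with h | h <;> linarith
  · rcases h2 with h | h <;> linarith
  · rcases h1 with h | h <;> linarith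

theorem halfOpenBox_finite (hfin : {p | ∀ i, κ p i ∈ Set.Icc (0 : ℝ) 1}.Finite) :
    (halfOpenBox κ y).Finite :=
  hfin.subset fun _ hp i => (halfOpenBox_bounds hp i).1

variable [Fintype ι] [DecidableEq ι]

/-- The reflection sends each coordinate `c` to `1 - c`, which swaps the two half-open conditions
defining the box. -/
theorem mem_halfOpenBox_neg (he : ∀ i, κ (e i) = Pi.single i 1) {p : M} :
    (∑ i, e i) - p ∈ halfOpenBox κ (-y) ↔ p ∈ halfOpenBox κ y := by
  have : κ (∑ i, e i) = 1 := by
    rw [map_sum]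
    ext j
    simp [he, Finset.sum_apply, Pi.single_apply]
  simp only [halfOpenBox, Set.mem_ofPred_eq, map_sub, this, sub_sub_cancel, neg_neg]
  exact and_comm

theorem map_add_sum_smul (he : ∀ i, κ (e i) = Pi.single i 1) (p : M) (n : ι → ℕ) (i : ι) :
    κ (p + ∑ j, n j • e j) i = κ p i + n i := by
  simp [map_sum, he, Finset.sum_apply, Pi.single_apply]

/-- The weighted lattice point sum of a slice of a half-open simplicial cone. -/
theorem finsum_halfOpen_eq (he : ∀ i, κ (e i) = Pi.single i 1)
    (hht : ∀ p, ∑ i, κ p i = ht p) (hy : ∀ i, y i ≠ 0)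
    (hfin : (halfOpenBox κ y).Finite) (N : ℤ) :
    ∑ᶠ p ∈ {p | ht p = N ∧ HalfOpen (κ p) y}, (q : RatFunc ℚ) ^ lam p =
      ∑ p ∈ hfin.toFinset, (q : RatFunc ℚ) ^ lam p *
        completeHomogeneous Finset.univ (fun i => (q : RatFunc ℚ) ^ lam (e i)) (N - ht p) := by
  have q0 : (q : RatFunc ℚ) ≠ 0 := Units.ne_zero q
  have hte : ∀ i, ht (e i) = 1 := fun i => by
    have h := hht (e i)
    simp only [he, Finset.sum_pi_single', Finset.mem_univ, if_true] at h
    exact_mod_cast h.symm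
  -- `R p` collects the exponent vectors that lift the box point `p` to height `N`.
  set R : M → Finset (ι →₀ ℕ) := fun p =>
    if 0 ≤ N - ht p then Finset.finsuppAntidiag Finset.univ (N - ht p).toNat else ∅ with hR
  have memR : ∀ p n, n ∈ R p ↔ ht p + ∑ i, (n i : ℤ) = N := by
    intro p n
    have h0 : 0 ≤ ∑ i, (n i : ℤ) := Finset.sum_nonneg fun i _ => by positivity
    simp only [hR]
    split_ifs with h
    · simp only [Finset.mem_finsuppAntidiag, Finset.subset_univ, and_true]
      rw [← Nat.cast_inj (R := ℤ), Int.toNat_of_nonneg h]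
      push_cast
      constructor <;> intro h <;> linarith
    · simp only [Finset.notMem_empty, false_iff]
      lia
  have hbij : Set.BijOn (fun x : Σ _ : M, ι →₀ ℕ => x.1 + ∑ i, x.2 i • e i)
      ↑(hfin.toFinset.sigma R) {p | ht p = N ∧ HalfOpen (κ p) y} := by
    refine ⟨?_, ?_, ?_⟩
    · rintro ⟨p, n⟩ hpn
      simp only [Finset.coe_sigma, Set.mem_sigma_iff, Finset.mem_coe, Set.Finite.mem_toFinset,
        memR] at hpn
      refine ⟨by simp [hte, hpn.2], fun i => ?_⟩
      rw [map_add_sum_smul he]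
      have hn : (0 : ℝ) ≤ n i := Nat.cast_nonneg _
      rcases hpn.1.1 i with h | ⟨h, h'⟩
      · exact Or.inl (by linarith)
      · rcases hn.lt_or_eq with h2 | h2
        · exact Or.inl (by linarith)
        · exact Or.inr ⟨by linarith, h'⟩
    · rintro ⟨p, n⟩ hpn ⟨p', n'⟩ hpn' heq
      simp only [Finset.coe_sigma, Set.mem_sigma_iff, Finset.mem_coe, Set.Finite.mem_toFinset,
        memR] at hpn hpn' heq
      have hn : n = n' := by
        ext i
        have h1 := congrArg (fun p => κ p i) heq
        simp only [map_add_sum_smul he] at h1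
        obtain ⟨⟨a1, a2⟩, a3, a4⟩ := halfOpenBox_bounds hpn.1 i
        obtain ⟨⟨b1, b2⟩, b3, b4⟩ := halfOpenBox_bounds hpn'.1 i
        -- Both box coordinates lie in the same half-open unit interval, so they differ by less than
        -- 1.
        have h2 : (n i : ℝ) < n' i + 1 ∧ (n' i : ℝ) < n i + 1 := by
          rcases (hy i).lt_or_gt with h | h
          · have := a4 h
            have := b4 h
            constructor <;> linarith
          · have := a3 h
            have := b3 h
            constructor <;> linarith
        obtain ⟨h3, h4⟩ := h2
        have h3 : n i < n' i + 1 := by exact_mod_cast h3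
        have h4 : n' i < n i + 1 := by exact_mod_cast h4
        lia
      subst hn
      simpa using heq
    · rintro p ⟨hp1, hp2⟩
      choose n hn using fun i => exists_halfOpen_decomposition (hy i) (hp2 i)
      have hκ : ∀ i, κ (p - ∑ j, n j • e j) i = κ p i - n i := fun i => by
        have := map_add_sum_smul he (p - ∑ j, n j • e j) n i
        rw [sub_add_cancel] at this
        linarith
      refine ⟨⟨p - ∑ i, n i • e i, Finsupp.equivFunOnFinite.symm n⟩, ?_, by simp⟩
      simp only [Finset.coe_sigma, Set.mem_sigma_iff, Finset.mem_coe, Set.Finite.mem_toFinset,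
        memR]
      refine ⟨⟨fun i => ?_, fun i => ?_⟩, by simp [hte, hp1]⟩
      · rw [hκ]
        exact (hn i).1
      · rw [Pi.sub_apply, hκ]
        exact (hn i).2
  rw [← finsum_mem_eq_of_bijOn _ hbij (fun x _ => rfl), finsum_mem_coe_finset, Finset.sum_sigma]
  refine Finset.sum_congr rfl fun p _ => ?_
  simp only [hR]
  split_ifs with h
  · conv_rhs => rw [← Int.toNat_of_nonneg h]
    rw [completeHomogeneous_natCast, Finset.mul_sum]
    refine Finset.sum_congr rfl fun n _ => ?_
    rw [map_add, zpow_add₀ q0, map_sum]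
    congr 1
    simp only [map_nsmul]
    rw [Finset.prod_congr rfl fun i _ => (zpow_natCast ((q : RatFunc ℚ) ^ lam (e i)) (n i)).symm]
    simp only [← zpow_mul]
    rw [prod_zpow_eq_zpow_sum q0]
    congr 1
    exact Finset.sum_congr rfl fun i _ => by rw [nsmul_eq_mul, mul_comm]
  · rw [completeHomogeneous_of_neg _ _ (not_le.1 h)]
    simp

/-- Ehrhart reciprocity for half-open simplicial cones. -/
theorem exists_isExpPoly_halfOpen [Nonempty ι] (he : ∀ i, κ (e i) = Pi.single i 1)
    (hht : ∀ p, ∑ i, κ p i = ht p) (hfin : {p | ∀ i, κ p i ∈ Set.Icc (0 : ℝ) 1}.Finite)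
    (hy : ∀ i, y i ≠ 0) (hpos : ∃ i, 0 < y i) :
    ∃ f, IsExpPoly f ∧
      (∀ N : ℕ, f N = ∑ᶠ p ∈ {p | ht p = N ∧ HalfOpen (κ p) y}, (q : RatFunc ℚ) ^ lam p) ∧
      ∀ N : ℕ, 1 ≤ N → invertQ (f (-N)) = (-1) ^ (Fintype.card ι - 1) *
        ∑ᶠ p ∈ {p | ht p = N ∧ HalfOpen (κ p) (-y)}, (q : RatFunc ℚ) ^ lam p := by
  have q0 : (q : RatFunc ℚ) ≠ 0 := Units.ne_zero q
  have hte : ∀ i, ht (e i) = 1 := fun i => by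
    have h := hht (e i)
    simp only [he, Finset.sum_pi_single', Finset.mem_univ, if_true] at h
    exact_mod_cast h.symm
  obtain ⟨H, hH, h1, h2⟩ :=
    exists_isExpPoly_completeHomogeneous (Finset.univ_nonempty (α := ι)) fun i => lam (e i)
  have fin1 := halfOpenBox_finite (y := y) hfin
  have fin2 := halfOpenBox_finite (y := -y) hfin
  refine ⟨fun n => ∑ p ∈ fin1.toFinset, (q : RatFunc ℚ) ^ lam p * H (n - ht p),
    IsExpPoly.sum _ fun p _ => (IsExpPoly.const _).mul (hH.shift _), fun N => ?_, fun N hN => ?_⟩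
  · rw [finsum_halfOpen_eq he hht hy fin1]
    refine Finset.sum_congr rfl fun p hp => ?_
    rw [Set.Finite.mem_toFinset] at hp
    rw [h1]
    -- A positive `y i` makes one box coordinate strictly less than 1. Hence `ht p < card ι`, so `N
    -- - ht p` stays in the range of `h1` even for `N = 0`.
    have hlt : ∑ i, κ p i < ∑ _i : ι, (1 : ℝ) := by
      obtain ⟨i, hi⟩ := hpos
      exact Finset.sum_lt_sum (fun i _ => (halfOpenBox_bounds hp i).1.2)
        ⟨i, Finset.mem_univ _, (halfOpenBox_bounds hp i).2.1 hi⟩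
    rw [hht, Finset.sum_const, nsmul_eq_mul, mul_one] at hlt
    have : ht p < ((Finset.univ : Finset ι).card : ℤ) := by exact_mod_cast hlt
    lia
  · rw [finsum_halfOpen_eq (y := -y) he hht (fun i => neg_ne_zero.2 (hy i)) fin2, map_sum,
      Finset.mul_sum]
    refine Finset.sum_bij' (fun p _ => (∑ i, e i) - p) (fun p _ => (∑ i, e i) - p) ?_ ?_ ?_ ?_ ?_
    · intro p hp
      rw [Set.Finite.mem_toFinset] at hp ⊢
      exact (mem_halfOpenBox_neg he).2 hp
    · intro p hp
      rw [Set.Finite.mem_toFinset] at hp ⊢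
      have := (mem_halfOpenBox_neg (y := -y) he).2 hp
      rwa [neg_neg] at this
    · simp
    · simp
    · intro p hp
      rw [Set.Finite.mem_toFinset] at hp
      have h0 : 0 ≤ ht p := by
        have : (0 : ℝ) ≤ ht p := by
          rw [← hht]
          exact Finset.sum_nonneg fun i _ => (halfOpenBox_bounds hp i).1.1
        exact_mod_cast this
      rw [h2 _ (by lia)]
      simp only [map_mul, map_completeHomogeneous, invertQ_q_zpow, map_pow, map_neg, map_one,
        neg_neg, map_sub, map_sum, hte, Finset.card_univ]
      rw [sub_eq_add_neg (∑ i, lam (e i)), zpow_add₀ q0]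
      have : -(-(N : ℤ) - ht p) - Fintype.card ι = N - (∑ _i : ι, 1 - ht p) := by
        simp
        ring
      rw [this]
      ring

end SimplicialCone

/-! ### Regular triangulations by linear programming -/

section Triangulation

open Filter Topology

/-- Finitely many nonzero linear forms are simultaneously nonzero at some positive vector. -/
theorem exists_pos_forall_sum_mul_ne_zero {ι κ : Type*} [Fintype ι] [Finite κ]
    (a : κ → ι → ℝ) (ha : ∀ k, a k ≠ 0) :
    ∃ y : ι → ℝ, (∀ i, 0 < y i) ∧ ∀ k, ∑ i, a k i * y i ≠ 0 := by
  classical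
  -- Search along the moment curve: each form restricts to a nonzero polynomial in `t`, with
  -- finitely many roots.
  let P : κ → ℝ[X] := fun k => ∑ i, Polynomial.monomial (Fintype.equivFin ι i : ℕ) (a k i)
  have hP : ∀ k, P k ≠ 0 := by
    intro k hk
    refine ha k (funext fun i => ?_)
    have h := congrArg (fun p => Polynomial.coeff p (Fintype.equivFin ι i : ℕ)) hk
    simpa [P, Polynomial.finsetSum_coeff, Polynomial.coeff_monomial, Fin.val_inj] using h
  have hfin : (⋃ k, {t | (P k).IsRoot t}).Finite :=
    Set.finite_iUnion fun k => Polynomial.finite_setOfPred_isRoot (hP k)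
  obtain ⟨t, ht, ht'⟩ := (Set.Ioi_infinite (0 : ℝ)).exists_notMem_finite hfin
  refine ⟨fun i => t ^ (Fintype.equivFin ι i : ℕ), fun i => pow_pos ht _, fun k h => ht' ?_⟩
  refine Set.mem_iUnion.2 ⟨k, ?_⟩
  simpa [P, Polynomial.IsRoot, Polynomial.eval_finsetSum] using h

variable {ι E : Type*} [NormedAddCommGroup E] [NormedSpace ℝ E]

/-- The subfamilies of `w` that are bases of the ambient space. -/
abbrev SubBasis (w : ι → E) : Type _ :=
  {B : Set ι // LinearIndepOn ℝ w B ∧ Submodule.span ℝ (w '' B) = ⊤}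

/-- Membership in the cone generated by the `w i`. -/
def InCone [Fintype ι] (w : ι → E) (p : E) : Prop :=
  ∃ z : ι → ℝ, (∀ i, 0 ≤ z i) ∧ ∑ i, z i • w i = p

/-- Membership in the relative interior of the cone generated by the `w i`. -/
def InOpenCone [Fintype ι] (w : ι → E) (p : E) : Prop :=
  ∃ z : ι → ℝ, (∀ i, 0 < z i) ∧ ∑ i, z i • w i = p

namespace SubBasis

variable {w : ι → E} (B : SubBasis w)

/-- The basis of the ambient space given by a basic subfamily. -/
def basis : Module.Basis B.1 ℝ E :=
  Module.Basis.mk (v := fun i : B.1 => w i) B.2.1 (by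
    have h := B.2.2
    rw [Set.image_eq_range] at h
    exact h.ge)

theorem basis_apply (i : B.1) : B.basis i = w i :=
  Module.Basis.mk_apply _ _ i

theorem repr_apply_self (i : B.1) : B.basis.repr (w i) i = 1 := by
  rw [← B.basis_apply i, Module.Basis.repr_self, Finsupp.single_eq_same]

open Classical in
/-- The coordinates in a basic subfamily, extended by zero. -/
def coord (v : E) (i : ι) : ℝ := if h : i ∈ B.1 then B.basis.repr v ⟨i, h⟩ else 0

theorem coord_coe (v : E) (i : B.1) : B.coord v i = B.basis.repr v i := by
  simp [coord]

theorem coord_of_notMem (v : E) {i : ι} (hi : i ∉ B.1) : B.coord v i = 0 := by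
  simp [coord, hi]

/-- The linear form taking the values `c i` on a basic subfamily. -/
def priceForm (c : ι → ℝ) : E →ₗ[ℝ] ℝ := B.basis.constr ℝ fun i => c i

theorem priceForm_apply_mem (c : ι → ℝ) {i : ι} (hi : i ∈ B.1) : B.priceForm c (w i) = c i := by
  have h := B.basis.constr_basis ℝ (fun i : B.1 => c i) ⟨i, hi⟩
  rwa [basis_apply] at h

variable [Fintype ι]

theorem sum_coord_smul {F : Type*} [AddCommGroup F] [Module ℝ F] (g : ι → F) (v : E) :
    ∑ i, B.coord v i • g i = B.basis.constr ℝ (fun i => g i) v := by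
  classical
  rw [Module.Basis.constr_apply_fintype, ← Fintype.sum_subtype_add_sum_subtype (· ∈ B.1)]
  rw [Finset.sum_eq_zero (s := (Finset.univ : Finset {x // x ∉ B.1}))
    (fun i _ => by rw [B.coord_of_notMem v i.2, zero_smul]), add_zero]
  exact Finset.sum_congr rfl fun i _ => by
    rw [Module.Basis.equivFun_apply]
    exact congrArg (· • g i) (B.coord_coe v i)

theorem sum_coord_smul_self (v : E) : ∑ i, B.coord v i • w i = v := by
  rw [sum_coord_smul]
  have : B.basis.constr ℝ (fun i : B.1 => w i) = LinearMap.id :=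
    B.basis.ext fun i => by rw [Module.Basis.constr_basis, LinearMap.id_apply, basis_apply]
  rw [this, LinearMap.id_apply]

theorem inCone {p : E} (h : ∀ i, 0 ≤ B.basis.repr p i) : InCone w p := by
  refine ⟨B.coord p, fun i => ?_, B.sum_coord_smul_self p⟩
  by_cases hi : i ∈ B.1
  · exact (h ⟨i, hi⟩).trans_eq (B.coord_coe p ⟨i, hi⟩).symm
  · exact (B.coord_of_notMem p hi).ge

theorem repr_sum_smul {z : ι → ℝ} (hz : ∀ i ∉ B.1, z i = 0) (b : B.1) :
    B.basis.repr (∑ i, z i • w i) b = z b := by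
  classical
  rw [map_sum, Finsupp.finsetSum_apply, Finset.sum_eq_single (b : ι)]
  · rw [map_smul, Finsupp.smul_apply, B.repr_apply_self, smul_eq_mul, mul_one]
  · intro i _ hi
    by_cases h : i ∈ B.1
    · have := B.basis_apply ⟨i, h⟩
      simp only at this
      rw [← this, map_smul, Module.Basis.repr_self, Finsupp.smul_apply,
        Finsupp.single_eq_of_ne (fun h => hi (congrArg Subtype.val h.symm)), smul_zero]
    · simp [hz i h]
  · simp

theorem sum_coord_mul (c : ι → ℝ) (v : E) : ∑ i, B.coord v i * c i = B.priceForm c v :=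
  B.sum_coord_smul c v

end SubBasis

variable [Fintype ι] {w : ι → E} {ht : E →ₗ[ℝ] ℝ}

theorem isCompact_feasible (hw : ∀ i, ht (w i) = 1) (p : E) :
    IsCompact {z : ι → ℝ | (∀ i, 0 ≤ z i) ∧ ∑ i, z i • w i = p} := by
  refine (isCompact_Icc (a := (0 : ι → ℝ)) (b := fun _ => ht p)).of_isClosed_subset ?_ ?_
  · have h1 : IsClosed {z : ι → ℝ | ∀ i, 0 ≤ z i} := by
      simp only [Set.ofPred_forall]
      exact isClosed_iInter fun i => isClosed_le continuous_const (continuous_apply i)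
    exact h1.inter (isClosed_eq (by fun_prop) continuous_const)
  · rintro z ⟨hz, rfl⟩
    refine ⟨fun i => hz i, fun i => ?_⟩
    simp only [map_sum, map_smul, hw, smul_eq_mul, mul_one]
    exact Finset.single_le_sum (fun i _ => hz i) (Finset.mem_univ i)

/-- A point in the cone has an optimal representation of minimal cost with linearly independent
support. -/
theorem exists_optimal_vertex (hw : ∀ i, ht (w i) = 1) (c : ι → ℝ) {p : E} (hp : InCone w p) :
    ∃ z : ι → ℝ, ((∀ i, 0 ≤ z i) ∧ ∑ i, z i • w i = p) ∧
      (∀ z' : ι → ℝ, (∀ i, 0 ≤ z' i) → ∑ i, z' i • w i = p →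
        ∑ i, z i * c i ≤ ∑ i, z' i * c i) ∧
      LinearIndepOn ℝ w {i | z i ≠ 0} := by
  classical
  obtain ⟨z₀, hz₀, hmin₀⟩ := (isCompact_feasible hw p).exists_isMinOn hp
    (f := fun z : ι → ℝ => ∑ i, z i * c i) (by fun_prop)
  let Opt : Set (ι → ℝ) := {z | ((∀ i, 0 ≤ z i) ∧ ∑ i, z i • w i = p) ∧
      ∀ z' : ι → ℝ, (∀ i, 0 ≤ z' i) → ∑ i, z' i • w i = p → ∑ i, z i * c i ≤ ∑ i, z' i * c i}
  have hOpt : z₀ ∈ Opt := ⟨hz₀, fun z' h1 h2 => hmin₀ (show _ ∧ _ from ⟨h1, h2⟩)⟩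
  -- Among the optima, one of smallest support: a dependency on that support would allow a
  -- cost-nonincreasing move that kills a coordinate.
  obtain ⟨z, ⟨⟨hz0, hzp⟩, hzmin⟩, hsupp⟩ := WellFounded.has_min
    (measure fun z : ι → ℝ => (Finset.univ.filter fun i => z i ≠ 0).card).wf Opt ⟨_, hOpt⟩
  refine ⟨z, ⟨hz0, hzp⟩, hzmin, ?_⟩
  by_contra hli
  have hS : {i | z i ≠ 0} = ((Finset.univ.filter fun i => z i ≠ 0 : Finset ι) : Set ι) := by
    ext; simp
  rw [hS, not_linearIndepOn_finset_iff] at hli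
  obtain ⟨f, hf, i₁, hi₁, hfi₁⟩ := hli
  obtain ⟨g, hgz, hgw, hgc, i₂, hgi₂⟩ : ∃ g : ι → ℝ, (∀ i, z i = 0 → g i = 0) ∧
      ∑ i, g i • w i = 0 ∧ ∑ i, g i * c i ≤ 0 ∧ ∃ i, g i ≠ 0 := by
    let g : ι → ℝ := fun i => if z i = 0 then 0 else f i
    have hg1 : ∑ i, g i • w i = 0 := by
      rw [← hf, Finset.sum_filter]
      exact Finset.sum_congr rfl fun i _ => by by_cases h : z i = 0 <;> simp [g, h]
    have hg2 : g i₁ ≠ 0 := by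
      simp only [Finset.mem_filter, Finset.mem_univ, true_and] at hi₁
      simpa [g, hi₁] using hfi₁
    rcases le_total (∑ i, g i * c i) 0 with h | h
    · exact ⟨g, fun i hi => by simp [g, hi], hg1, h, i₁, hg2⟩
    · refine ⟨-g, fun i hi => by simp [g, hi], ?_, ?_, i₁, by simpa using hg2⟩
      · simpa using hg1
      · simpa using h
  -- All `w i` have height 1, so a dependency has coefficient sum zero and hence a negative entry.
  have hgsum : ∑ i, g i = 0 := by
    have h := congrArg ht hgw
    simpa [map_sum, hw] using h
  have hneg : ∃ i, g i < 0 := by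
    by_contra! hge
    exact hgi₂ ((Finset.sum_eq_zero_iff_of_nonneg fun i _ => hge i).1 hgsum i₂ (Finset.mem_univ _))
  obtain ⟨i₀, hi₀, hi₀min⟩ := Finset.exists_min_image (Finset.univ.filter fun i => g i < 0)
    (fun i => z i / -g i) (by obtain ⟨i, hi⟩ := hneg; exact ⟨i, by simpa using hi⟩)
  simp only [Finset.mem_filter, Finset.mem_univ, true_and] at hi₀ hi₀min
  -- Ratio test: the largest step along `g` keeping all coordinates nonnegative; it annihilates
  -- coordinate `i₀`.
  set t := z i₀ / -g i₀ with ht_def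
  have ht0 : 0 ≤ t := div_nonneg (hz0 _) (by linarith)
  have hz'0 : ∀ i, 0 ≤ z i + t * g i := by
    intro i
    rcases le_or_gt 0 (g i) with h | h
    · have := hz0 i
      positivity
    · have := hi₀min i h
      rw [le_div_iff₀ (by linarith)] at this
      linarith
  have hz'w : ∑ i, (z i + t * g i) • w i = p := by
    simp only [add_smul, mul_smul, Finset.sum_add_distrib, ← Finset.smul_sum, hgw, hzp, smul_zero,
      add_zero]
  have hz'c : ∑ i, (z i + t * g i) * c i ≤ ∑ i, z i * c i := by
    simp only [add_mul, mul_assoc, Finset.sum_add_distrib, ← Finset.mul_sum]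
    have := mul_nonpos_of_nonneg_of_nonpos ht0 hgc
    linarith
  refine hsupp (fun i => z i + t * g i) ⟨⟨hz'0, hz'w⟩, fun z' h1 h2 =>
    hz'c.trans (hzmin z' h1 h2)⟩ ?_
  refine Finset.card_lt_card (Finset.ssubset_iff_of_subset ?_ |>.2 ⟨i₀, ?_, ?_⟩)
  · intro i hi
    simp only [Finset.mem_filter, Finset.mem_univ, true_and] at hi ⊢
    intro h
    exact hi (by rw [h, hgz i h]; ring)
  · simp only [Finset.mem_filter, Finset.mem_univ, true_and]
    intro h
    rw [hgz i₀ h] at hi₀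
    exact lt_irrefl _ hi₀
  · simp only [Finset.mem_filter, Finset.mem_univ, true_and, not_not, ht_def]
    field_simp [hi₀.ne]
    ring

/-- A generic point of the cone lies in a basic cone whose prices are dual feasible. -/
theorem exists_optimal_basis (hspan : Submodule.span ℝ (Set.range w) = ⊤)
    (hw : ∀ i, ht (w i) = 1) (c : ι → ℝ) {p : E}
    (hgen : ∀ (B : SubBasis w) i, B.basis.repr p i ≠ 0) (hp : InCone w p) :
    ∃ B : SubBasis w, (∀ j, B.priceForm c (w j) ≤ c j) ∧ ∀ i, 0 < B.basis.repr p i := by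
  classical
  obtain ⟨z, ⟨hz0, hzp⟩, hzmin, hli⟩ := exists_optimal_vertex hw c hp
  let B : SubBasis w := ⟨hli.extend (Set.subset_univ _), hli.linearIndepOn_extend _, by
    rw [hli.span_image_extend_eq_span_image, Set.image_univ, hspan]⟩
  have hB : ∀ i ∉ B.1, z i = 0 := fun i hi => by
    by_contra h
    exact hi (hli.subset_extend (Set.subset_univ _) h)
  have hrepr : ∀ b, B.basis.repr p b = z b := fun b => by
    rw [← hzp, B.repr_sum_smul hB]
  have hpos : ∀ b, 0 < B.basis.repr p b := fun b =>
    lt_of_le_of_ne (by rw [hrepr]; exact hz0 b) (hgen B b).symm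
  refine ⟨B, fun j => ?_, hpos⟩
  by_contra! hj
  have hjB : j ∉ B.1 := fun h => by
    rw [B.priceForm_apply_mem c h] at hj
    exact lt_irrefl _ hj
  -- Simplex pivot: bring in `δ` of `w j` and compensate in the basis. The cost changes by `δ * (c j
  -- - price of w j)`, which is negative and contradicts optimality.
  have hev : ∀ᶠ δ : ℝ in 𝓝[>] 0, ∀ i, 0 ≤ z i + δ * (Pi.single (M := fun _ => ℝ) j 1 i - B.coord (w j) i) := by
    rw [eventually_all]
    intro i
    by_cases hi : i ∈ B.1
    · have hzi : 0 < z i := by simpa only [hrepr] using hpos ⟨i, hi⟩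
      have hc : Tendsto (fun δ : ℝ => z i + δ * (Pi.single (M := fun _ => ℝ) j 1 i - B.coord (w j) i)) (𝓝[>] 0)
          (𝓝 (z i + 0 * (Pi.single (M := fun _ => ℝ) j 1 i - B.coord (w j) i))) :=
        (Continuous.tendsto (by fun_prop) 0).mono_left nhdsWithin_le_nhds
      rw [zero_mul, add_zero] at hc
      filter_upwards [hc.eventually (lt_mem_nhds hzi)] with δ hδ using hδ.le
    · filter_upwards [self_mem_nhdsWithin] with δ (hδ : 0 < δ)
      rw [B.coord_of_notMem _ hi, sub_zero]
      have h1 : (0 : ℝ) ≤ Pi.single (M := fun _ => ℝ) j 1 i := by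
        by_cases h : i = j
        · subst h; simp
        · simp [h]
      have := hz0 i
      positivity
  obtain ⟨δ, hδ, hδ0⟩ := (hev.and self_mem_nhdsWithin).exists
  have hδ0 : 0 < δ := hδ0
  have h1 := hzmin _ hδ (by
    simp only [add_smul, mul_smul, sub_smul, Finset.sum_add_distrib, ← Finset.smul_sum,
      Finset.sum_sub_distrib, B.sum_coord_smul_self, hzp]
    simp [Pi.single_apply])
  simp only [add_mul, mul_assoc, sub_mul, Finset.sum_add_distrib, ← Finset.mul_sum,
      Finset.sum_sub_distrib, B.sum_coord_mul] at h1
  have h2 : ∑ i, Pi.single (M := fun _ => ℝ) j 1 i * c i = c j := by simp [Pi.single_apply]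
  rw [h2] at h1
  nlinarith

/-- With generic costs, dual feasible basic cones do not overlap at generic points. -/
theorem optimal_basis_unique {c : ι → ℝ} {p : E} {B B' : SubBasis w}
    (hc : ∀ j ∉ B.1, B.priceForm c (w j) ≠ c j) (hc' : ∀ j ∉ B'.1, B'.priceForm c (w j) ≠ c j)
    (hB : ∀ j, B.priceForm c (w j) ≤ c j) (hB' : ∀ j, B'.priceForm c (w j) ≤ c j)
    (hp : ∀ i, 0 < B.basis.repr p i) (hp' : ∀ i, 0 < B'.basis.repr p i) : B = B' := by
  -- Weak duality: expand `p` in `B'` and compare prices with costs. Equality forces complementary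
  -- slackness, hence containment of the bases.
  have key : ∀ {B B' : SubBasis w}, (∀ j, B.priceForm c (w j) ≤ c j) →
      (∀ i, 0 < B'.basis.repr p i) → B.priceForm c p ≤ B'.priceForm c p ∧
      ((∀ j ∉ B.1, B.priceForm c (w j) ≠ c j) →
        B'.priceForm c p ≤ B.priceForm c p → B'.1 ⊆ B.1) := by
    intro B B' hB hp'
    have hnn : ∀ i, 0 ≤ B'.coord p i := fun i => by
      by_cases hi : i ∈ B'.1
      · exact (hp' ⟨i, hi⟩).le.trans_eq (B'.coord_coe p ⟨i, hi⟩).symm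
      · exact (B'.coord_of_notMem p hi).ge
    have e1 : B.priceForm c p = ∑ i, B'.coord p i * B.priceForm c (w i) := by
      conv_lhs => rw [← B'.sum_coord_smul_self p]
      simp [map_sum]
    have e2 : B'.priceForm c p = ∑ i, B'.coord p i * c i := (B'.sum_coord_mul c p).symm
    refine ⟨?_, fun hc hle i hi => ?_⟩
    · rw [e1, e2]
      exact Finset.sum_le_sum fun i _ => mul_le_mul_of_nonneg_left (hB i) (hnn i)
    · by_contra hiB
      refine hle.not_gt ?_
      rw [e1, e2]
      refine Finset.sum_lt_sum (fun i _ => mul_le_mul_of_nonneg_left (hB i) (hnn i))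
        ⟨i, Finset.mem_univ _, mul_lt_mul_of_pos_left (lt_of_le_of_ne (hB i) (hc i hiB)) ?_⟩
      exact (hp' ⟨i, hi⟩).trans_eq (B'.coord_coe p ⟨i, hi⟩).symm
  have h1 := key hB hp'
  have h2 := key hB' hp
  exact Subtype.ext ((h2.2 hc' h1.1).antisymm (h1.2 hc h2.1))

/-- This identifies `HalfOpen` membership of a point with open-cone membership of its small generic
displacement. -/
theorem eventually_pos_iff {c y : ℝ} (hy : y ≠ 0) :
    ∀ᶠ ε : ℝ in 𝓝[>] 0, c + ε * y ≠ 0 ∧ (0 < c + ε * y ↔ (0 < c ∨ (c = 0 ∧ 0 < y))) := by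
  have ht : Tendsto (fun ε : ℝ => c + ε * y) (𝓝[>] 0) (𝓝 c) := by
    have : Tendsto (fun ε : ℝ => c + ε * y) (𝓝[>] 0) (𝓝 (c + 0 * y)) :=
      (Continuous.tendsto (by fun_prop) 0).mono_left nhdsWithin_le_nhds
    simpa using this
  rcases lt_trichotomy c 0 with hc | hc | hc
  · filter_upwards [ht.eventually (gt_mem_nhds hc)] with ε hε
    refine ⟨hε.ne, ?_⟩
    simp [hc.ne, hc.not_gt, hε.not_gt]
  · subst hc
    filter_upwards [self_mem_nhdsWithin] with ε (hε : 0 < ε)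
    simp [hε.ne', hy, hε]
  · filter_upwards [ht.eventually (lt_mem_nhds hc)] with ε hε
    exact ⟨hε.ne', by simp [hc, hε]⟩

/-- The cone over the points `w i` is the disjoint union of half-open simplicial cones, and its
relative interior is the disjoint union of the oppositely half-open cones. -/
theorem exists_halfOpen_triangulation [Nonempty ι] (hspan : Submodule.span ℝ (Set.range w) = ⊤)
    (hw : ∀ i, ht (w i) = 1) :
    ∃ (T : Set (SubBasis w)) (Y : E), (∀ (B : SubBasis w) i, B.basis.repr Y i ≠ 0) ∧
      (∀ B : SubBasis w, ∃ i, 0 < B.basis.repr Y i) ∧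
      (∀ p, InCone w p → ∃! B : T, HalfOpen (B.1.basis.repr p) (B.1.basis.repr Y)) ∧
      (∀ p, ∀ B : T, HalfOpen (B.1.basis.repr p) (B.1.basis.repr Y) → InCone w p) ∧
      (∀ p, InOpenCone w p → ∃! B : T, HalfOpen (B.1.basis.repr p) (-⇑(B.1.basis.repr Y))) ∧
      (∀ p, ∀ B : T, HalfOpen (B.1.basis.repr p) (-⇑(B.1.basis.repr Y)) → InOpenCone w p) := by
  classical
  -- Generic costs: no generator outside a basis has reduced cost zero.
  obtain ⟨c, -, hc⟩ := exists_pos_forall_sum_mul_ne_zero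
    (fun k : Σ B : SubBasis w, {j // j ∉ B.1} => Pi.single k.2.1 1 - k.1.coord (w k.2))
    (fun k h => by
      have := congrFun h k.2
      simp [k.1.coord_of_notMem _ k.2.2] at this)
  have hc' : ∀ (B : SubBasis w), ∀ j ∉ B.1, B.priceForm c (w j) ≠ c j := by
    intro B j hj h
    refine hc ⟨B, j, hj⟩ ?_
    simp only [Pi.sub_apply, sub_mul, Finset.sum_sub_distrib, B.sum_coord_mul, h]
    simp [Pi.single_apply]
  obtain ⟨y, hy0, hy⟩ := exists_pos_forall_sum_mul_ne_zero
    (fun k : Σ B : SubBasis w, B.1 => fun i => k.1.basis.repr (w i) k.2)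
    (fun k h => by
      have := congrFun h k.2
      rw [k.1.repr_apply_self] at this
      exact one_ne_zero this)
  set Y : E := ∑ i, y i • w i with hY
  have hYrepr : ∀ (B : SubBasis w) i, B.basis.repr Y i ≠ 0 := by
    intro B i h
    refine hy ⟨B, i⟩ ?_
    rw [hY, map_sum, Finsupp.finsetSum_apply] at h
    rw [← h]
    exact Finset.sum_congr rfl fun j _ => by simp [mul_comm]
  set T : Set (SubBasis w) := {B | ∀ j, B.priceForm c (w j) ≤ c j} with hT
  -- For small `ε` the point `p + ε • s` avoids all facet hyperplanes, so the linear program assigns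
  -- it to exactly one basic cone of `T`. Used with `s = Y` for the cone and `s = -Y` for its
  -- interior.
  have generic : ∀ (s p : E), (∀ (B : SubBasis w) i, B.basis.repr s i ≠ 0) →
      ∀ᶠ ε : ℝ in 𝓝[>] 0, 0 < ε ∧ (∀ B : T, HalfOpen (B.1.basis.repr p) (B.1.basis.repr s) →
        InCone w (p + ε • s)) ∧ (InCone w (p + ε • s) →
        ∃! B : T, HalfOpen (B.1.basis.repr p) (B.1.basis.repr s)) := by
    intro s p hs
    have hev : ∀ᶠ ε : ℝ in 𝓝[>] 0, ∀ (B : SubBasis w) (i : B.1),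
        B.basis.repr p i + ε * B.basis.repr s i ≠ 0 ∧ (0 < B.basis.repr p i + ε * B.basis.repr s i ↔
          (0 < B.basis.repr p i ∨ (B.basis.repr p i = 0 ∧ 0 < B.basis.repr s i))) := by
      rw [eventually_all]
      intro B
      rw [eventually_all]
      exact fun i => eventually_pos_iff (hs B i)
    filter_upwards [hev, self_mem_nhdsWithin] with ε hε (hε0 : 0 < ε)
    have hr : ∀ (B : SubBasis w) i, B.basis.repr (p + ε • s) i =
        B.basis.repr p i + ε * B.basis.repr s i := fun B i => by simp
    have hiff : ∀ B : SubBasis w, HalfOpen (B.basis.repr p) (B.basis.repr s) ↔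
        ∀ i, 0 < B.basis.repr (p + ε • s) i := fun B =>
      forall_congr' fun i => by rw [hr, (hε B i).2]
    refine ⟨hε0, fun B hB => B.1.inCone fun i => ((hiff B.1).1 hB i).le, fun hp => ?_⟩
    obtain ⟨B, hB1, hB2⟩ := exists_optimal_basis hspan hw c
      (fun B i => by rw [hr]; exact (hε B i).1) hp
    refine ⟨⟨B, hB1⟩, (hiff B).2 hB2, fun B' hB' => Subtype.ext ?_⟩
    exact optimal_basis_unique (hc' _) (hc' _) B'.2 hB1 ((hiff B'.1).1 hB') hB2
  refine ⟨T, Y, hYrepr, fun B => ?_, fun p hp => ?_, fun p B hB => ?_, fun p hp => ?_,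
    fun p B hB => ?_⟩
  -- `Y` has positive height, and its height is the sum of its coordinates in any basis.
  · by_contra! hle
    have h1 : ht Y = ∑ i, y i := by simp [hY, map_sum, hw]
    have h2 : 0 < ∑ i, y i := Finset.sum_pos (fun i _ => hy0 i) Finset.univ_nonempty
    have h3 : ht Y = ∑ i, B.coord Y i := by
      conv_lhs => rw [← B.sum_coord_smul_self Y]
      simp [map_sum, hw]
    have h4 : ∑ i, B.coord Y i ≤ 0 := Finset.sum_nonpos fun i _ => by
      by_cases hi : i ∈ B.1
      · exact (B.coord_coe Y ⟨i, hi⟩).trans_le (hle ⟨i, hi⟩)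
      · exact (B.coord_of_notMem Y hi).le
    linarith
  · obtain ⟨ε, hε0, -, hε⟩ := (generic Y p hYrepr).exists
    refine hε ?_
    obtain ⟨z, hz, rfl⟩ := hp
    refine ⟨fun i => z i + ε * y i, fun i => ?_, ?_⟩
    · have := hz i
      have := hy0 i
      positivity
    · simp only [add_smul, mul_smul, Finset.sum_add_distrib, ← Finset.smul_sum, hY]
  · refine B.1.inCone fun i => ?_
    rcases hB i with h | h
    · exact h.le
    · exact h.1.ge
  · have hneg : ∀ (B : SubBasis w) i, B.basis.repr (-Y) i ≠ 0 := fun B i => by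
      simpa using hYrepr B i
    obtain ⟨z, hz, rfl⟩ := hp
    have hev : ∀ᶠ ε : ℝ in 𝓝[>] 0, ∀ i, 0 < z i + ε * (-y i) := by
      rw [eventually_all]
      intro i
      filter_upwards [eventually_pos_iff (c := z i) (neg_ne_zero.2 (hy0 i).ne')] with ε hε
      exact hε.2.2 (Or.inl (hz i))
    obtain ⟨ε, ⟨hε0, -, hε⟩, hz'⟩ := ((generic (-Y) (∑ i, z i • w i) hneg).and hev).exists
    simp only [map_neg, Finsupp.coe_neg] at hε
    refine hε ⟨fun i => z i + ε * (-y i), fun i => (hz' i).le, ?_⟩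
    simp only [add_smul, mul_smul, neg_smul, Finset.sum_add_distrib, Finset.sum_neg_distrib,
      ← Finset.smul_sum, hY]
  · have hneg : ∀ (B : SubBasis w) i, B.basis.repr (-Y) i ≠ 0 := fun B i => by
      simpa using hYrepr B i
    obtain ⟨ε, hε0, hε, -⟩ := (generic (-Y) p hneg).exists
    simp only [map_neg, Finsupp.coe_neg] at hε
    -- `p - ε • Y` is in the cone; adding back `ε • Y`, all of whose coefficients are positive,
    -- gives positive coefficients for `p`.
    obtain ⟨z, hz, hzp⟩ := hε B hB
    refine ⟨fun i => z i + ε * y i, fun i => ?_, ?_⟩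
    · have := hz i
      have := hy0 i
      positivity
    · simp only [add_smul, mul_smul, Finset.sum_add_distrib, ← Finset.smul_sum, hzp, ← hY]
      simp

end Triangulation

/-! ### Relative interior of a polytope by positive convex combinations -/

section ConvexHull

open Filter Topology

variable {ι F : Type*} [Fintype ι]

theorem mem_convexHull_range_iff [AddCommGroup F] [Module ℝ F] (u : ι → F) (x : F) :
    x ∈ convexHull ℝ (Set.range u) ↔
      ∃ z : ι → ℝ, (∀ i, 0 ≤ z i) ∧ ∑ i, z i = 1 ∧ ∑ i, z i • u i = x := by
  classical
  have h : Set.range u = Fintype.linearCombination ℝ u '' Set.range fun i => Pi.single i 1 := by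
    rw [← Set.range_comp]
    congr 1
    ext i
    simp [Fintype.linearCombination_apply, Pi.single_apply]
  rw [h, ← LinearMap.image_convexHull, convexHull_rangle_single_eq_stdSimplex]
  simp only [Set.mem_image, stdSimplex, Set.mem_ofPred_eq, Fintype.linearCombination_apply,
    and_assoc]

/-- The relative interior of a polytope consists of the convex combinations of its vertices in
which all coefficients are positive. -/
theorem mem_intrinsicInterior_convexHull_range_iff [Nonempty ι] [NormedAddCommGroup F]
    [NormedSpace ℝ F] [FiniteDimensional ℝ F] (u : ι → F) (x : F) :
    x ∈ intrinsicInterior ℝ (convexHull ℝ (Set.range u)) ↔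
      ∃ z : ι → ℝ, (∀ i, 0 < z i) ∧ ∑ i, z i = 1 ∧ ∑ i, z i • u i = x := by
  set K := convexHull ℝ (Set.range u) with hK
  constructor
  · intro hx
    obtain ⟨x', hx', rfl⟩ := mem_intrinsicInterior.1 hx
    have hn : (0 : ℝ) < Fintype.card ι := by exact_mod_cast Fintype.card_pos
    set a : F := ∑ i : ι, (Fintype.card ι : ℝ)⁻¹ • u i with ha
    have haK : a ∈ K := (mem_convexHull_range_iff u a).2
      ⟨fun _ => (Fintype.card ι : ℝ)⁻¹, fun _ => by positivity, by simp [hn.ne'], rfl⟩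
    let a' : affineSpan ℝ K := ⟨a, subset_affineSpan ℝ K haK⟩
    -- Move from `x'` slightly away from the barycentre `a`, staying in `K`; then `x'` is a convex
    -- combination giving `a` positive weight.
    let g : ℝ → affineSpan ℝ K := fun ε =>
      ⟨AffineMap.lineMap (x' : F) (a' : F) (-ε), AffineMap.lineMap_mem _ x'.2 a'.2⟩
    have hg : Continuous g := Continuous.subtype_mk
      (AffineMap.lineMap_continuous.comp continuous_neg) _
    have hg0 : g 0 = x' := Subtype.ext (by simp [g])
    have hev : ∀ᶠ ε : ℝ in 𝓝[>] 0, (g ε : F) ∈ K := by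
      have h1 : ((↑) ⁻¹' K : Set (affineSpan ℝ K)) ∈ 𝓝 (g 0) := by
        rw [hg0]
        exact mem_interior_iff_mem_nhds.1 hx'
      exact (hg.tendsto 0).mono_left nhdsWithin_le_nhds h1
    obtain ⟨ε, hε, hε0⟩ := (hev.and self_mem_nhdsWithin).exists
    have hε0 : 0 < ε := hε0
    obtain ⟨z, hz, hz1, hzx⟩ := (mem_convexHull_range_iff u _).1 hε
    refine ⟨fun i => (z i + ε * (Fintype.card ι : ℝ)⁻¹) / (1 + ε), fun i => ?_, ?_, ?_⟩
    · have := hz i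
      positivity
    · rw [← Finset.sum_div, Finset.sum_add_distrib, hz1]
      simp only [Finset.sum_const, Finset.card_univ, nsmul_eq_mul]
      field_simp
    · have h1 : ∑ i, ((z i + ε * (Fintype.card ι : ℝ)⁻¹) / (1 + ε)) • u i =
          (1 + ε)⁻¹ • (∑ i, z i • u i + ε • a) := by
        rw [ha, Finset.smul_sum, ← Finset.sum_add_distrib, Finset.smul_sum]
        exact Finset.sum_congr rfl fun i _ => by module
      rw [h1, hzx]
      simp only [g, AffineMap.lineMap_apply_module, a']
      rw [inv_smul_eq_iff₀ (by positivity)]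
      module
  · rintro ⟨z, hz, hz1, rfl⟩
    set x := ∑ i, z i • u i with hx
    have hKconv : Convex ℝ K := convex_convexHull ℝ _
    obtain ⟨k, hk⟩ := Set.Nonempty.intrinsicInterior hKconv
      (Set.Nonempty.convexHull (Set.range_nonempty u))
    obtain ⟨k', hk', rfl⟩ := mem_intrinsicInterior.1 hk
    obtain ⟨y, hy, hy1, hyk⟩ := (mem_convexHull_range_iff u _).1 (intrinsicInterior_subset hk)
    have hev : ∀ᶠ ε : ℝ in 𝓝[>] 0, ∀ i, 0 ≤ (1 + ε) * z i - ε * y i := by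
      rw [eventually_all]
      intro i
      have hc : Tendsto (fun ε : ℝ => (1 + ε) * z i - ε * y i) (𝓝[>] 0)
          (𝓝 ((1 + 0) * z i - 0 * y i)) :=
        (Continuous.tendsto (by fun_prop) 0).mono_left nhdsWithin_le_nhds
      have hzi := hz i
      filter_upwards [hc.eventually (lt_mem_nhds (a := 0) (by simpa using hzi))] with ε hε
        using hε.le
    obtain ⟨ε, hε, hε0⟩ := (hev.and self_mem_nhdsWithin).exists
    have hε0 : 0 < ε := hε0
    have hxK : x ∈ K := (mem_convexHull_range_iff u x).2 ⟨z, fun i => (hz i).le, hz1, rfl⟩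
    -- `x` lies between `b ∈ K` and the relative interior point `k'`. The homothety `g` centred at
    -- `b` maps `x` to `k'`, and by convexity any point it sends into `K` is itself in `K`.
    set b : F := (1 + ε) • x - ε • (k' : F) with hb
    have hbK : b ∈ K := by
      refine (mem_convexHull_range_iff u b).2 ⟨_, hε, ?_, ?_⟩
      · rw [Finset.sum_sub_distrib, ← Finset.mul_sum, ← Finset.mul_sum, hz1, hy1]
        ring
      · simp only [sub_smul, mul_smul, Finset.sum_sub_distrib, ← Finset.smul_sum, hyk, hb, hx]
    let x' : affineSpan ℝ K := ⟨x, subset_affineSpan ℝ K hxK⟩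
    let g : affineSpan ℝ K → affineSpan ℝ K := fun p =>
      ⟨AffineMap.lineMap b (p : F) ((1 + ε) / ε),
        AffineMap.lineMap_mem _ (subset_affineSpan ℝ K hbK) p.2⟩
    have hg : Continuous g := by
      refine Continuous.subtype_mk ?_ _
      simp only [AffineMap.lineMap_apply_module]
      fun_prop
    have hgx : g x' = k' := by
      refine Subtype.ext ?_
      simp only [g, x', AffineMap.lineMap_apply_module, hb]
      match_scalars <;> field_simp <;> ring
    refine mem_intrinsicInterior.2 ⟨x', ?_, rfl⟩
    rw [mem_interior_iff_mem_nhds] at hk' ⊢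
    rw [← hgx] at hk'
    filter_upwards [hg.continuousAt hk'] with p hp
    have h1 := hKconv hbK hp (show 0 ≤ (1 + ε)⁻¹ by positivity)
      (show 0 ≤ ε * (1 + ε)⁻¹ by positivity) (by field_simp)
    have h2 : (1 + ε)⁻¹ • b + (ε * (1 + ε)⁻¹) • (g p : F) = p := by
      simp only [g, AffineMap.lineMap_apply_module]
      match_scalars <;> field_simp <;> ring
    rwa [h2] at h1

end ConvexHull

/-! ### Lattice points and homogenization -/

section LatticePolytope

variable {m : ℕ}

/-- The lattice `ℤ^m × ℤ` inside `ℝ^m × ℝ`. -/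
def latticeEmbedding (m : ℕ) : (Fin m → ℤ) × ℤ →+ (Fin m → ℝ) × ℝ :=
  AddMonoidHom.mk' (fun p => (latticePoint p.1, (p.2 : ℝ))) fun p r => by
    ext <;> simp [latticePoint]

theorem latticeEmbedding_apply (p : (Fin m → ℤ) × ℤ) :
    latticeEmbedding m p = (latticePoint p.1, (p.2 : ℝ)) := rfl

theorem finite_latticeEmbedding_preimage {S : Set ((Fin m → ℝ) × ℝ)} (hS : Bornology.IsBounded S) :
    {p | latticeEmbedding m p ∈ S}.Finite := by
  have h1 := finite_latticePoints (hS.image_fst)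
  have h2 : {n : ℤ | (n : ℝ) ∈ Prod.snd '' S}.Finite := by
    obtain ⟨R, hR⟩ := hS.image_snd.exists_norm_le
    refine (Set.finite_Icc (-⌈R⌉) ⌈R⌉).subset fun n hn => ?_
    have h := (hR _ hn).trans (Int.le_ceil R)
    rw [Real.norm_eq_abs, abs_le] at h
    exact ⟨by exact_mod_cast h.1, by exact_mod_cast h.2⟩
  exact (h1.prod h2).subset fun p hp =>
    ⟨⟨_, hp, rfl⟩, ⟨_, hp, rfl⟩⟩

/-- The span is the direction space at height 0 plus one line at nonzero height. This ties the
number of generators of a basic cone to `dim Q`. -/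
theorem finrank_span_homogenization {ι : Type*} [Nonempty ι] (v : ι → Fin m → ℝ) :
    Module.finrank ℝ (Submodule.span ℝ (Set.range fun i => (v i, (1 : ℝ)))) =
      Module.finrank ℝ (vectorSpan ℝ (Set.range v)) + 1 := by
  obtain ⟨i₀⟩ := ‹Nonempty ι›
  set W := (vectorSpan ℝ (Set.range v)).map (LinearMap.inl ℝ (Fin m → ℝ) ℝ) with hW
  have hsup : Submodule.span ℝ (Set.range fun i => (v i, (1 : ℝ))) =
      W ⊔ Submodule.span ℝ {(v i₀, (1 : ℝ))} := by
    refine le_antisymm (Submodule.span_le.2 ?_) (sup_le ?_ (Submodule.span_mono ?_))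
    · rintro _ ⟨i, rfl⟩
      refine Submodule.mem_sup.2 ⟨(v i - v i₀, 0), ⟨v i - v i₀, ?_, rfl⟩, (v i₀, 1),
        Submodule.mem_span_singleton_self _, by simp⟩
      exact vsub_mem_vectorSpan ℝ (Set.mem_range_self i) (Set.mem_range_self i₀)
    · rw [hW, vectorSpan_eq_span_vsub_set_right ℝ (Set.mem_range_self i₀), Submodule.map_span,
        Submodule.span_le]
      rintro _ ⟨_, ⟨_, ⟨i, rfl⟩, rfl⟩, rfl⟩
      have h := Submodule.sub_mem _
        (Submodule.subset_span (R := ℝ) (Set.mem_range_self (f := fun i => (v i, (1 : ℝ))) i))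
        (Submodule.subset_span (R := ℝ) (Set.mem_range_self (f := fun i => (v i, (1 : ℝ))) i₀))
      simpa using h
    · rintro _ rfl
      exact ⟨i₀, rfl⟩
  have hinf : W ⊓ Submodule.span ℝ {(v i₀, (1 : ℝ))} = ⊥ := by
    rw [eq_bot_iff]
    rintro _ ⟨⟨x, -, rfl⟩, hx⟩
    obtain ⟨c, hc⟩ := Submodule.mem_span_singleton.1 hx
    have h2 := congrArg Prod.snd hc
    simp at h2
    subst h2
    rw [← hc]
    simp
  have h := Submodule.finrank_sup_add_finrank_inf_eq W (Submodule.span ℝ {(v i₀, (1 : ℝ))})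
  rw [hinf, finrank_bot, add_zero, finrank_span_singleton (by simp), hW,
    ← (Submodule.equivMapOfInjective _ LinearMap.inl_injective _).finrank_eq] at h
  rw [hsup, h]

/-- A weighted lattice point sum is computed by any partition of the corresponding slice of a
lattice. -/
theorem weightedSum_eq_sum {τ : Type*} [Fintype τ] (L : AddSubgroup ((Fin m → ℤ) × ℤ))
    (lam : (Fin m → ℤ) →ₗ[ℤ] ℤ) {S : Set (Fin m → ℝ)} (hS : Bornology.IsBounded S) (N : ℤ)
    (t : τ → Set L) (hmem : ∀ x, latticePoint x ∈ S → (x, N) ∈ L)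
    (ht : ∀ b p, p ∈ t b → p.1.2 = N ∧ latticePoint p.1.1 ∈ S)
    (hu : ∀ p : L, p.1.2 = N → latticePoint p.1.1 ∈ S → ∃! b, p ∈ t b) :
    weightedSum lam S = ∑ b, ∑ᶠ p ∈ t b, (q : RatFunc ℚ) ^ lam p.1.1 := by
  have hbij : Set.BijOn (fun p : L => p.1.1) (⋃ b, t b) {x | latticePoint x ∈ S} := by
    refine ⟨fun p hp => ?_, fun p hp p' hp' h => ?_, fun x hx => ?_⟩
    · obtain ⟨b, hb⟩ := Set.mem_iUnion.1 hp
      exact (ht b p hb).2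
    · obtain ⟨b, hb⟩ := Set.mem_iUnion.1 hp
      obtain ⟨b', hb'⟩ := Set.mem_iUnion.1 hp'
      exact Subtype.ext (Prod.ext h ((ht b p hb).1.trans (ht b' p' hb').1.symm))
    · obtain ⟨b, hb, -⟩ := hu ⟨(x, N), hmem x hx⟩ rfl hx
      exact ⟨_, Set.mem_iUnion.2 ⟨b, hb⟩, rfl⟩
  have hfin : (⋃ b, t b).Finite := hbij.finite_iff_finite.2 (finite_latticePoints hS)
  have hdisj : Pairwise (Function.onFun Disjoint t) := fun b b' hbb' =>
    Set.disjoint_left.2 fun p hp hp' => hbb' <| by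
      obtain ⟨h1, h2⟩ := ht b p hp
      exact (hu p h1 h2).unique hp hp'
  rw [weightedSum, ← finsum_mem_eq_of_bijOn (f := fun p : L => (q : RatFunc ℚ) ^ lam p.1.1) _ hbij
    (fun p _ => by rw [Units.val_zpow_eq_zpow_val]),
    finsum_mem_iUnion hdisj fun b => hfin.subset (Set.subset_iUnion t b), finsum_eq_sum_of_fintype]

end LatticePolytope

/-! ### Dilates of polytopes -/

section Dilates

variable {ι F : Type*} [Fintype ι] [Nonempty ι]

theorem mem_smul_convexHull_range_iff [AddCommGroup F] [Module ℝ F] (v : ι → F) {s : ℝ}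
    (hs : 0 ≤ s) (x : F) :
    x ∈ s • convexHull ℝ (Set.range v) ↔
      ∃ z : ι → ℝ, (∀ i, 0 ≤ z i) ∧ ∑ i, z i = s ∧ ∑ i, z i • v i = x := by
  rw [Set.mem_smul_set]
  constructor
  · rintro ⟨y, hy, rfl⟩
    obtain ⟨z, hz, hz1, rfl⟩ := (mem_convexHull_range_iff v y).1 hy
    refine ⟨fun i => s * z i, fun i => mul_nonneg hs (hz i), ?_, ?_⟩
    · rw [← Finset.mul_sum, hz1, mul_one]
    · simp only [mul_smul, Finset.smul_sum]
  · rintro ⟨z, hz, rfl, rfl⟩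
    rcases hs.lt_or_eq with hs | hs
    · refine ⟨∑ i, (z i / ∑ j, z j) • v i, (mem_convexHull_range_iff v _).2
        ⟨_, fun i => div_nonneg (hz i) hs.le, ?_, rfl⟩, ?_⟩
      · rw [← Finset.sum_div, div_self hs.ne']
      · rw [Finset.smul_sum]
        exact Finset.sum_congr rfl fun i _ => by rw [smul_smul, mul_div_cancel₀ _ hs.ne']
    -- For `s = 0` the dilate is the origin alone; a point of the hull is still needed, whence
    -- `Nonempty ι`.
    · have h0 : ∀ i, z i = 0 := fun i =>
        (Finset.sum_eq_zero_iff_of_nonneg fun i _ => hz i).1 hs.symm i (Finset.mem_univ i)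
      obtain ⟨i⟩ := ‹Nonempty ι›
      exact ⟨v i, subset_convexHull ℝ _ (Set.mem_range_self i), by simp [h0]⟩

theorem mem_intrinsicInterior_smul_convexHull_range_iff [NormedAddCommGroup F] [NormedSpace ℝ F]
    [FiniteDimensional ℝ F] (v : ι → F) {s : ℝ} (hs : 0 < s) (x : F) :
    x ∈ intrinsicInterior ℝ (s • convexHull ℝ (Set.range v)) ↔
      ∃ z : ι → ℝ, (∀ i, 0 < z i) ∧ ∑ i, z i = s ∧ ∑ i, z i • v i = x := by
  have h : s • Set.range v = Set.range fun i => s • v i := by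
    rw [← Set.image_smul, ← Set.range_comp]
    rfl
  rw [← convexHull_smul, h, mem_intrinsicInterior_convexHull_range_iff]
  constructor
  · rintro ⟨z, hz, hz1, rfl⟩
    refine ⟨fun i => s * z i, fun i => mul_pos hs (hz i), ?_, ?_⟩
    · rw [← Finset.mul_sum, hz1, mul_one]
    · exact Finset.sum_congr rfl fun i _ => by rw [smul_smul, mul_comm]
  · rintro ⟨z, hz, rfl, rfl⟩
    refine ⟨fun i => z i / ∑ j, z j, fun i => div_pos (hz i) hs, ?_, ?_⟩
    · rw [← Finset.sum_div, div_self hs.ne']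
    · exact Finset.sum_congr rfl fun i _ => by rw [smul_smul, div_mul_cancel₀ _ hs.ne']

end Dilates

theorem SubBasis.sum_repr_eq {ι E : Type*} [NormedAddCommGroup E] [NormedSpace ℝ E]
    {w : ι → E} {ht : E →ₗ[ℝ] ℝ} (hw : ∀ i, ht (w i) = 1) (B : SubBasis w) [Fintype B.1] (p : E) :
    ∑ i, B.basis.repr p i = ht p := by
  conv_rhs => rw [← B.basis.sum_repr p]
  simp [map_sum, basis_apply, hw]

/-! ### The cone over the polytope and its lattice -/

section Homogenization

variable {m : ℕ} (V : Finset (Fin m → ℤ))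

/-- The linear span of the homogenized vertices `(v, 1)`. -/
abbrev homSpan : Submodule ℝ ((Fin m → ℝ) × ℝ) :=
  Submodule.span ℝ (Set.range fun v : V => (latticePoint v.1, (1 : ℝ)))

/-- The homogenized vertices. -/
def homVertex (v : V) : homSpan V :=
  ⟨(latticePoint v.1, 1), Submodule.subset_span (Set.mem_range_self v)⟩

/-- The height on the span of the homogenized vertices. -/
def homHeight : homSpan V →ₗ[ℝ] ℝ := (LinearMap.snd ℝ _ _).comp (homSpan V).subtype

/-- The lattice points in the span of the homogenized vertices. -/
abbrev homLattice : AddSubgroup ((Fin m → ℤ) × ℤ) :=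
  (homSpan V).toAddSubgroup.comap (latticeEmbedding m)

/-- The embedding of the lattice into the span of the homogenized vertices. -/
def homLatticeEmbedding : homLattice V →+ homSpan V :=
  AddMonoidHom.mk' (fun p => ⟨latticeEmbedding m p.1, p.2⟩) fun p r =>
    Subtype.ext (map_add (latticeEmbedding m) p.1 r.1)

variable {V}

theorem homHeight_homVertex (v : V) : homHeight V (homVertex V v) = 1 := rfl

theorem span_homVertex : Submodule.span ℝ (Set.range (homVertex V)) = ⊤ := by
  apply Submodule.map_injective_of_injective (homSpan V).injective_subtype
  rw [Submodule.map_span, Submodule.map_subtype_top, ← Set.range_comp]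
  rfl

theorem sum_smul_homVertex_eq_iff (z : V → ℝ) (p : homLattice V) :
    ∑ i, z i • homVertex V i = homLatticeEmbedding V p ↔
      ∑ i, z i = p.1.2 ∧ ∑ i, z i • latticePoint i.1 = latticePoint p.1.1 := by
  rw [← (homSpan V).injective_subtype.eq_iff, map_sum, Prod.ext_iff, and_comm, Prod.fst_sum,
    Prod.snd_sum]
  simp [homVertex, homLatticeEmbedding, latticeEmbedding_apply]

theorem inCone_homVertex_iff [Nonempty V] (p : homLattice V) (N : ℕ) (hN : p.1.2 = N) :
    InCone (homVertex V) (homLatticeEmbedding V p) ↔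
      latticePoint p.1.1 ∈
        (N : ℝ) • convexHull ℝ (Set.range fun v : V => latticePoint v.1) := by
  rw [mem_smul_convexHull_range_iff _ N.cast_nonneg]
  simp only [InCone, sum_smul_homVertex_eq_iff, hN, Int.cast_natCast]

theorem inOpenCone_homVertex_iff [Nonempty V] (p : homLattice V) (N : ℕ) (hN1 : 1 ≤ N)
    (hN : p.1.2 = N) :
    InOpenCone (homVertex V) (homLatticeEmbedding V p) ↔
      latticePoint p.1.1 ∈ intrinsicInterior ℝ
        ((N : ℝ) • convexHull ℝ (Set.range fun v : V => latticePoint v.1)) := by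
  rw [mem_intrinsicInterior_smul_convexHull_range_iff _ (by exact_mod_cast hN1)]
  simp only [InOpenCone, sum_smul_homVertex_eq_iff, hN, Int.cast_natCast]

theorem mem_homLattice_of_mem_smul [Nonempty V] {x : Fin m → ℤ} {N : ℕ}
    (hx : latticePoint x ∈
      (N : ℝ) • convexHull ℝ (Set.range fun v : V => latticePoint v.1)) :
    (x, (N : ℤ)) ∈ homLattice V := by
  obtain ⟨z, -, hz, hzx⟩ := (mem_smul_convexHull_range_iff _ N.cast_nonneg _).1 hx
  have h : latticeEmbedding m (x, (N : ℤ)) =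
      ∑ i : V, z i • (latticePoint i.1, (1 : ℝ)) := by
    rw [latticeEmbedding_apply, Prod.ext_iff, Prod.fst_sum, Prod.snd_sum]
    simpa using And.intro hzx.symm hz.symm
  rw [AddSubgroup.mem_comap, h]
  exact Submodule.sum_mem _ fun i _ =>
    Submodule.smul_mem _ _ (Submodule.subset_span (Set.mem_range_self i))

/-- The coordinates of lattice points in a basic family of vertices. -/
def latticeCoord (B : SubBasis (homVertex V)) : homLattice V →+ (B.1 → ℝ) :=
  AddMonoidHom.mk' (fun p => B.basis.repr (homLatticeEmbedding V p)) fun p r => by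
    ext i
    simp

theorem latticeCoord_apply (B : SubBasis (homVertex V)) (p : homLattice V) :
    latticeCoord B p = B.basis.repr (homLatticeEmbedding V p) := rfl

/-- The homogenized vertices as lattice points. -/
def latticeVertex (v : V) : homLattice V := ⟨(v.1, 1), by
  have h : latticeEmbedding m (v.1, 1) = (homVertex V v : (Fin m → ℝ) × ℝ) := by
    simp [latticeEmbedding_apply, homVertex]
  rw [AddSubgroup.mem_comap, h]
  exact (homVertex V v).2⟩

theorem homLatticeEmbedding_latticeVertex (v : V) :
    homLatticeEmbedding V (latticeVertex v) = homVertex V v :=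
  Subtype.ext (by simp [homLatticeEmbedding, latticeVertex, latticeEmbedding_apply, homVertex])

/-- Coordinates in `[0, 1]` bound the norm by the sum of the norms of the generators. -/
theorem finite_latticeCoord_mem_Icc (B : SubBasis (homVertex V)) :
    {p | ∀ i, latticeCoord B p i ∈ Set.Icc (0 : ℝ) 1}.Finite := by
  classical
  have hb : Bornology.IsBounded (Metric.closedBall (0 : (Fin m → ℝ) × ℝ)
      (∑ v : V, ‖homVertex V v‖)) := Metric.isBounded_closedBall
  refine ((finite_latticeEmbedding_preimage hb).preimage
    Subtype.val_injective.injOn).subset fun p hp => ?_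
  have h0 : ∀ v, B.coord (homLatticeEmbedding V p) v ∈ Set.Icc (0 : ℝ) 1 := fun v => by
    by_cases hv : v ∈ B.1
    · rw [show B.coord _ v = _ from B.coord_coe _ ⟨v, hv⟩]
      exact hp ⟨v, hv⟩
    · rw [B.coord_of_notMem _ hv]
      simp
  show latticeEmbedding m p.1 ∈ Metric.closedBall 0 _
  rw [mem_closedBall_zero_iff]
  change ‖homLatticeEmbedding V p‖ ≤ _
  rw [← B.sum_coord_smul_self (homLatticeEmbedding V p)]
  refine (norm_sum_le _ _).trans (Finset.sum_le_sum fun v _ => ?_)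
  rw [norm_smul, Real.norm_of_nonneg (h0 v).1]
  exact mul_le_of_le_one_left (norm_nonneg _) (h0 v).2

theorem exists_isExpPoly_basicCone [Nonempty V] (lam : (Fin m → ℤ) →ₗ[ℤ] ℤ)
    (B : SubBasis (homVertex V)) {Y : homSpan V} (hY : ∀ i, B.basis.repr Y i ≠ 0)
    (hpos : ∃ i, 0 < B.basis.repr Y i) :
    ∃ f, IsExpPoly f ∧
      (∀ N : ℕ, f N = ∑ᶠ p ∈ {p : homLattice V | p.1.2 = N ∧
        HalfOpen (B.basis.repr (homLatticeEmbedding V p)) (B.basis.repr Y)},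
          (q : RatFunc ℚ) ^ lam p.1.1) ∧
      ∀ N : ℕ, 1 ≤ N → invertQ (f (-N)) =
        (-1) ^ dim (convexHull ℝ (Set.range fun v : V => latticePoint v.1)) *
        ∑ᶠ p ∈ {p : homLattice V | p.1.2 = N ∧
          HalfOpen (B.basis.repr (homLatticeEmbedding V p)) (-⇑(B.basis.repr Y))},
            (q : RatFunc ℚ) ^ lam p.1.1 := by
  classical
  have : Fintype B.1 := Fintype.ofFinite _
  obtain ⟨i₀, hi₀⟩ := hpos
  have : Nonempty B.1 := ⟨i₀⟩
  -- The sign exponent does not depend on `B`: every basic family has `dim Q + 1` members.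
  have hdim : dim (convexHull ℝ (Set.range fun v : V => latticePoint v.1)) =
      Fintype.card B.1 - 1 := by
    rw [← Module.finrank_eq_card_basis B.basis, finrank_span_homogenization, dim,
      ← direction_affineSpan, affineSpan_convexHull, direction_affineSpan, Nat.add_sub_cancel]
  rw [hdim]
  exact exists_isExpPoly_halfOpen (κ := latticeCoord B) (e := fun i => latticeVertex i.1)
    (ht := (AddMonoidHom.snd _ _).comp (homLattice V).subtype)
    (lam := (lam.toAddMonoidHom.comp (AddMonoidHom.fst _ _)).comp (homLattice V).subtype)
    (fun i => by
      rw [latticeCoord_apply, homLatticeEmbedding_latticeVertex, ← B.basis_apply,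
        Module.Basis.repr_self, Finsupp.single_eq_pi_single])
    (fun p => B.sum_repr_eq homHeight_homVertex _)
    (finite_latticeCoord_mem_Icc B) hY ⟨i₀, hi₀⟩

end Homogenization

end QEhrhart

end

/-! ### Assembling the pieces -/

theorem theoremq (m : ℕ) (Q : Set (Fin m → ℝ)) (hQ : QEhrhart.IsLatticePolytope Q)
    (lam : (Fin m → ℤ) →ₗ[ℤ] ℤ) :
    ∃ E : QEhrhart.TwoVarLaurent,
      (∀ N : ℕ,
        QEhrhart.evalAt (RingHom.id (RatFunc ℚ)) (QEhrhart.q ^ N) (N : RatFunc ℚ) E =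
          QEhrhart.weightedSum lam ((N : ℝ) • Q)) ∧
      (∀ N : ℕ, 1 ≤ N →
        QEhrhart.evalAt QEhrhart.invertQ (QEhrhart.q ^ N)
            (-(N : RatFunc ℚ)) E =
          (-1) ^ QEhrhart.dim Q *
            QEhrhart.weightedSum lam (intrinsicInterior ℝ ((N : ℝ) • Q))) := by
  classical
  obtain ⟨V, rfl⟩ := hQ
  rw [Set.image_eq_range]
  change ∃ E : QEhrhart.TwoVarLaurent,
    (∀ N : ℕ, _ = QEhrhart.weightedSum lam ((N : ℝ) •
      convexHull ℝ (Set.range fun v : V => QEhrhart.latticePoint v.1))) ∧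
    (∀ N : ℕ, _ → _ = (-1) ^ QEhrhart.dim (convexHull ℝ
      (Set.range fun v : V => QEhrhart.latticePoint v.1)) *
      QEhrhart.weightedSum lam (intrinsicInterior ℝ ((N : ℝ) •
        convexHull ℝ (Set.range fun v : V => QEhrhart.latticePoint v.1))))
  -- The empty polytope is allowed; all its sums vanish, so `E = 0` serves.
  rcases isEmpty_or_nonempty V with hV | hV
  · rw [Set.range_eq_empty, convexHull_empty]
    refine ⟨0, ?_, ?_⟩ <;> simp [QEhrhart.evalAt, QEhrhart.weightedSum]
  set K := convexHull ℝ (Set.range fun v : V => QEhrhart.latticePoint v.1) with hK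
  have hbdd : ∀ N : ℕ, Bornology.IsBounded ((N : ℝ) • K) := fun N =>
    Bornology.IsBounded.smul₀ (isBounded_convexHull.2 (Set.finite_range _).isBounded) _
  obtain ⟨T, Y, hY, hYpos, h1, h2, h3, h4⟩ := QEhrhart.exists_halfOpen_triangulation
    (QEhrhart.span_homVertex (V := V)) QEhrhart.homHeight_homVertex
  choose f hf hf1 hf2 using fun B : T =>
    QEhrhart.exists_isExpPoly_basicCone lam B.1 (hY B.1) (hYpos B.1)
  obtain ⟨E, hE⟩ := QEhrhart.IsExpPoly.sum Finset.univ fun B _ => hf B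
  refine ⟨E, fun N => ?_, fun N hN => ?_⟩
  · have h := hE N
    rw [zpow_natCast, Int.cast_natCast] at h
    rw [← h, QEhrhart.weightedSum_eq_sum (QEhrhart.homLattice V) lam (hbdd N) N
      (fun B : T => {p | p.1.2 = N ∧ QEhrhart.HalfOpen
        (B.1.basis.repr (QEhrhart.homLatticeEmbedding V p)) (B.1.basis.repr Y)})
      (fun x hx => QEhrhart.mem_homLattice_of_mem_smul hx)
      (fun B p hp => ⟨hp.1, (QEhrhart.inCone_homVertex_iff p N hp.1).1 (h2 _ B hp.2)⟩)
      (fun p hp hpS => by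
        simpa [hp] using h1 _ ((QEhrhart.inCone_homVertex_iff p N hp).2 hpS))]
    exact Finset.sum_congr rfl fun B _ => hf1 B N
  · have h := QEhrhart.evalAt_invertQ E N
    rw [← hE, zpow_natCast, Int.cast_natCast, map_sum] at h
    rw [h, QEhrhart.weightedSum_eq_sum (QEhrhart.homLattice V) lam
      ((hbdd N).subset intrinsicInterior_subset) N
      (fun B : T => {p | p.1.2 = N ∧ QEhrhart.HalfOpen
        (B.1.basis.repr (QEhrhart.homLatticeEmbedding V p)) (-⇑(B.1.basis.repr Y))})
      (fun x hx => QEhrhart.mem_homLattice_of_mem_smul (intrinsicInterior_subset hx))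
      (fun B p hp => ⟨hp.1, (QEhrhart.inOpenCone_homVertex_iff p N hN hp.1).1 (h4 _ B hp.2)⟩)
      (fun p hp hpS => by
        simpa [hp] using h3 _ ((QEhrhart.inOpenCone_homVertex_iff p N hN hp).2 hpS)),
      Finset.mul_sum]
    exact Finset.sum_congr rfl fun B _ => hf2 B N hN
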